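/- Let $\Phi=\{\Phi(t)\}_{t\in\mathbb{R}}$ be a real-valued, (jointly) measurable, mean-square continuous, stationary Gaussian process whose covariance function has an integrable spectral density $p:\mathbb{R}\to(0,\infty)$, i.e. $\mathrm{Cov}(\Phi(t),\Phi(0))=\int_{\mathbb{R}}e^{it\lambda}p(\lambda)\,d\lambda$ for all $t\in\mathbb{R}$; the mean of $\Phi$ is an arbitrary constant. Let $\psi\in L^1(\mathbb{R})\cap L^2(\mathbb{R})$ be a complex-valued analytic wavelet, i.e. $\widehat\psi(\omega)=\int_{\mathbb{R}}e^{-it\omega}\psi(t)\,dt=0$ for all $\omega\le 0$. For $t\in\mathbb{R}$ and $s>0$ let $$W_\Phi(t,s)=\int_{\mathbb{R}}\Phi(\tau)\,\frac1s\,\overline{\psi\Big(\frac{\tau-t}{s}\Big)}\,d\tau,\qquad S_\Phi(t,s)=|W_\Phi(t,s)|^2,$$ where, for each $t$ and $s$, the integral converges absolutely almost surely, and write $W^R_\Phi=\mathrm{Re}\,W_\Phi$, $W^I_\Phi=\mathrm{Im}\,W_\Phi$. Then: (a) For any $t\in\mathbb{R}$, $d\in\mathbb{N}$ and $s_1,\dots,s_d>0$,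 the random vector $\mathbf{W}=(W_\Phi(t,s_1),\dots,W_\Phi(t,s_d))^\top$ is a complex Gaussian vector (its real and imaginary parts are jointly Gaussian) and is circularly symmetric: $e^{i\theta}\mathbf{W}$ has the same distribution as $\mathbf{W}$ for every $\theta\in\mathbb{R}$. (b) Suppose in addition that $\psi$ is not almost everywhere zero. For any $t\in\mathbb{R}$ and $s_1,s_2>0$ with $s_1\ne s_2$, the number $d_{W_\Phi}(s_1,s_2)=\{\mathbb{E}[|W_\Phi(0,s_1)-W_\Phi(0,s_2)|^2]\}^{1/2}$ is positive and $$\frac{|W_\Phi(t,s_1)-W_\Phi(t,s_2)|^2}{d_{W_\Phi}(s_1,s_2)^2}$$ follows the exponential distribution with mean one. (c) For any $t\in\mathbb{R}$ and $s_1,s_2>0$, $$\mathrm{Cov}\big(S_\Phi(t,s_1),S_\Phi(t,s_2)\big)=4\big\{\mathbb{E}[W^R_\Phi(t,s_1)W^R_\Phi(t,s_2)]\big\}^2+4\big\{\mathbb{E}[W^R_\Phi(t,s_1)W^I_\Phi(t,s_2)]\big\}^2\ge 0 .$$ In particular, for any $s>0$, $$\mathrm{Var}\big(S_\Phi(t,s)\big)=4\big\{\mathbb{E}[|W^R_\Phi(t,s)|^2]\big\}^2=\big\{\mathbb{E}[S_\Phi(t,s)]\big\}^2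 .$$ -/

import Mathlib

open MeasureTheory ProbabilityTheory Filter Topology
open scoped ComplexConjugate

noncomputable section

/-- The Fourier transform with the angular-frequency convention, `∫ e^{-i t ω} ψ(t) dt`. -/
def angularFourier (ψ : ℝ → ℂ) (ω : ℝ) : ℂ :=
  ∫ t : ℝ, Complex.exp (-(Complex.I * t * ω)) * ψ t

/-- A mother wavelet `ψ ∈ L¹ ∩ L²` whose Fourier transform vanishes on `(-∞, 0]`. -/
structure IsAnalyticWavelet (ψ : ℝ → ℂ) : Prop where
  integrable : Integrable ψ
  memLp_two : MemLp ψ 2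
  analytic : ∀ ω : ℝ, ω ≤ 0 → angularFourier ψ ω = 0

/-- The integrand of the wavelet transform of the signal `f` at time `t` and scale `s`. -/
def waveletIntegrand (ψ : ℝ → ℂ) (f : ℝ → ℝ) (t s τ : ℝ) : ℂ :=
  (f τ : ℂ) * (((1 / s : ℝ) : ℂ) * conj (ψ ((τ - t) / s)))

/-- The wavelet transform of the signal `f` at time `t` and scale `s`. -/
def waveletTransform (ψ : ℝ → ℂ) (f : ℝ → ℝ) (t s : ℝ) : ℂ :=
  ∫ τ : ℝ, waveletIntegrand ψ f t s τ

section Noise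

variable {Ω : Type*} [MeasurableSpace Ω]

/-- Strict stationarity: the law of the process is invariant under time shifts. -/
def IsStationaryProcess (Φ : ℝ → Ω → ℝ) (P : Measure Ω) : Prop :=
  ∀ h : ℝ, IdentDistrib (fun ω t ↦ Φ (t + h) ω) (fun ω t ↦ Φ t ω) P P

/-- Mean-square continuity: `E|Φ(u) - Φ(t)|² → 0` as `u → t`. -/
def IsMeanSquareContinuous (Φ : ℝ → Ω → ℝ) (P : Measure Ω) : Prop :=
  ∀ t : ℝ, Tendsto (fun u ↦ ∫ ω, (Φ u ω - Φ t ω) ^ 2 ∂P) (𝓝 t) (𝓝 0)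

/-- A real, (jointly) measurable, mean-square continuous, stationary Gaussian process whose
covariance function has the strictly positive spectral density `p`. The mean is arbitrary. -/
structure IsStationaryGaussianNoise (Φ : ℝ → Ω → ℝ) (P : Measure Ω) (p : ℝ → ℝ) : Prop where
  measurable : Measurable (Function.uncurry Φ)
  gaussian : IsGaussianProcess Φ P
  stationary : IsStationaryProcess Φ P
  meanSquareContinuous : IsMeanSquareContinuous Φ P
  density_pos : ∀ ξ : ℝ, 0 < p ξ
  density_integrable : Integrable p
  covariance_eq : ∀ t : ℝ, ((cov[Φ t, Φ 0; P] : ℝ) : ℂ) =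
    ∫ ξ : ℝ, Complex.exp (Complex.I * t * ξ) * (p ξ : ℂ)

/-- The wavelet transform `W_Φ(t, s)` of a random process, taken path by path. -/
def noiseAWT (ψ : ℝ → ℂ) (Φ : ℝ → Ω → ℝ) (t s : ℝ) (ω : Ω) : ℂ :=
  waveletTransform ψ (fun τ ↦ Φ τ ω) t s

/-- The scalogram `S_Φ(t, s) = |W_Φ(t, s)|²`. -/
def noiseScalogram (ψ : ℝ → ℂ) (Φ : ℝ → Ω → ℝ) (t s : ℝ) (ω : Ω) : ℝ :=
  ‖noiseAWT ψ Φ t s ω‖ ^ 2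

/-- The canonical distance `(E|W_Φ(0, s₁) - W_Φ(0, s₂)|²)^{1/2}`. -/
def canonicalDist (ψ : ℝ → ℂ) (Φ : ℝ → Ω → ℝ) (P : Measure Ω) (s₁ s₂ : ℝ) : ℝ :=
  Real.sqrt (∫ ω, ‖noiseAWT ψ Φ 0 s₁ ω - noiseAWT ψ Φ 0 s₂ ω‖ ^ 2 ∂P)

/-- Circular symmetry of a complex random vector: `e^{iθ} X` has the law of `X` for every real
`θ`. -/
def IsCircularlySymmetric {d : ℕ} (X : Ω → Fin d → ℂ) (P : Measure Ω) : Prop :=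
  ∀ θ : ℝ, IdentDistrib (fun ω ↦ Complex.exp (Complex.I * θ) • X ω) X P P

end Noise

end

/-! `W_Φ(t, s)` is the pathwise integral of `Φ` against the kernel `h(τ) = s⁻¹ conj ψ((τ - t)/s)`.
Conjugation reflects frequencies, so `ĥ` vanishes on `[0, ∞)`. Such antianalytic kernels form a
complex vector space, which is why everything is proved for general kernels.

Fubini and the spectral density give `E[∫Φf · ∫Φg] = ∫ p(ξ) f̂(-ξ) ĝ(ξ) dξ` as soon as `∫ f = 0`
(`integral_kernelIntegral_mul`). If `f` and `g` are both antianalytic, one of the two factors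
vanishes at every `ξ`, so the pseudo-covariance is zero (`integral_kernelIntegral_mul_eq_zero`). The
mean is zero as well, because `ĥ(0) = 0`.

Gaussianity: a real functional of the vector is the real part of one kernel integral. By Fubini this
is orthogonal to everything orthogonal to all the `Φ t`, so it lies in their closed span in `L²`,
where all elements are Gaussian. Circular symmetry follows because such a functional is centred with
variance `E|∫Φk|² / 2`, which is unchanged when `k` is multiplied by a phase.

For (b), `E|W(s₁) - W(s₂)|² = ∫ p(ξ) |ψ̂(s₁ξ) - ψ̂(s₂ξ)|² dξ`. If this vanished, `ψ̂` would be
invariant under a nontrivial dilation, hence constantly `ψ̂(0) = 0`. The exponential law comes from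
independent real and imaginary parts of equal variance. For (c), the fourth-moment formula for
Gaussian pairs is combined with the identities expressing zero pseudo-covariance. -/

/-! ### Gaussian variables form a closed subset of `L²`. -/

section L2

variable {Ω : Type*} [MeasurableSpace Ω] {P : Measure Ω}

lemma integral_norm_sub_le_norm_Lp_two [IsProbabilityMeasure P] (f g : Lp ℝ 2 P) :
    ∫ ω, ‖f ω - g ω‖ ∂P ≤ ‖f - g‖ := by
  have h1 : ∫ ω, ‖f ω - g ω‖ ∂P = ∫ ω, ‖(f - g) ω‖ ∂P := by
    refine integral_congr_ae ?_
    filter_upwards [Lp.coeFn_sub f g] with ω h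
    rw [h, Pi.sub_apply]
  rw [h1, Lp.norm_def, integral_norm_eq_lintegral_enorm (Lp.aestronglyMeasurable _),
    ← eLpNorm_one_eq_lintegral_enorm]
  exact ENNReal.toReal_mono (Lp.eLpNorm_ne_top _)
    (eLpNorm_le_eLpNorm_of_exponent_le (by norm_num) (Lp.aestronglyMeasurable _))

lemma integrable_Lp_two [IsProbabilityMeasure P] (f : Lp ℝ 2 P) : Integrable f P :=
  (Lp.memLp f).integrable (by norm_num)

lemma continuous_integral_Lp_two [IsProbabilityMeasure P] :
    Continuous fun f : Lp ℝ 2 P ↦ ∫ ω, f ω ∂P := by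
  refine (LipschitzWith.of_dist_le_mul (K := 1) fun f g ↦ ?_).continuous
  rw [dist_eq_norm, dist_eq_norm, NNReal.coe_one, one_mul,
    ← integral_sub (integrable_Lp_two f) (integrable_Lp_two g)]
  exact (norm_integral_le_integral_norm _).trans (integral_norm_sub_le_norm_Lp_two f g)

lemma Complex.norm_exp_mul_I_sub_exp_mul_I_le (x y : ℝ) :
    ‖Complex.exp (x * Complex.I) - Complex.exp (y * Complex.I)‖ ≤ |x - y| := by
  have h : Complex.exp (x * Complex.I) - Complex.exp (y * Complex.I)
      = Complex.exp (y * Complex.I) * (Complex.exp (Complex.I * ((x - y : ℝ) : ℂ)) - 1) := by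
    rw [mul_sub, ← Complex.exp_add, mul_one]
    push_cast
    ring_nf
  rw [h, norm_mul, Complex.norm_exp_ofReal_mul_I, one_mul]
  exact Real.norm_exp_I_mul_ofReal_sub_one_le

lemma integrable_exp_mul_I [IsFiniteMeasure P] {X : Ω → ℝ} (hX : AEMeasurable X P) :
    Integrable (fun ω ↦ Complex.exp ((X ω : ℂ) * Complex.I)) P := by
  refine Integrable.of_bound (C := 1) ?_ (ae_of_all _ fun ω ↦ ?_)
  · exact (by fun_prop : AEMeasurable (fun ω ↦ Complex.exp ((X ω : ℂ) * Complex.I)) P).aestronglyMeasurable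
  · rw [Complex.norm_exp_ofReal_mul_I]

lemma continuous_integral_exp_Lp_two [IsProbabilityMeasure P] (t : ℝ) :
    Continuous fun f : Lp ℝ 2 P ↦ ∫ ω, Complex.exp (((t * f ω : ℝ) : ℂ) * Complex.I) ∂P := by
  refine (LipschitzWith.of_dist_le_mul (K := ⟨|t|, abs_nonneg t⟩) fun f g ↦ ?_).continuous
  have hf := (Lp.aestronglyMeasurable f).aemeasurable
  have hg := (Lp.aestronglyMeasurable g).aemeasurable
  rw [dist_eq_norm, dist_eq_norm, ← integral_sub (integrable_exp_mul_I (hf.const_mul t))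
    (integrable_exp_mul_I (hg.const_mul t))]
  refine (norm_integral_le_integral_norm _).trans ?_
  calc _ ≤ ∫ ω, |t| * ‖f ω - g ω‖ ∂P := by
        refine integral_mono ?_ ?_ fun ω ↦ ?_
        · exact ((integrable_exp_mul_I (hf.const_mul t)).sub
            (integrable_exp_mul_I (hg.const_mul t))).norm
        · exact ((integrable_Lp_two f).sub (integrable_Lp_two g)).norm.const_mul _
        · refine (Complex.norm_exp_mul_I_sub_exp_mul_I_le _ _).trans_eq ?_
          rw [← mul_sub, abs_mul, Real.norm_eq_abs]
    _ = |t| * ∫ ω, ‖f ω - g ω‖ ∂P := integral_const_mul _ _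
    _ ≤ |t| * ‖f - g‖ := by
        gcongr
        exact integral_norm_sub_le_norm_Lp_two f g

lemma integral_sq_Lp_two (f : Lp ℝ 2 P) : ∫ ω, f ω ^ 2 ∂P = ‖f‖ ^ 2 := by
  rw [← real_inner_self_eq_norm_sq, L2.inner_def]
  simp [sq]

/-- A square integrable variable is Gaussian iff its characteristic function is the Gaussian one. -/
lemma hasGaussianLaw_iff_integral_exp [IsProbabilityMeasure P] (f : Lp ℝ 2 P) :
    HasGaussianLaw f P ↔ ∀ t : ℝ, ∫ ω, Complex.exp (((t * f ω : ℝ) : ℂ) * Complex.I) ∂P =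
      Complex.exp ((t * (∫ ω, f ω ∂P : ℝ) : ℂ) * Complex.I
        - t ^ 2 * ((‖f‖ ^ 2 - (∫ ω, f ω ∂P) ^ 2 : ℝ) : ℂ) / 2) := by
  have hf := (Lp.aestronglyMeasurable f).aemeasurable
  rw [hasGaussianLaw_iff_charFun_map_eq hf]
  refine forall_congr' fun t ↦ ?_
  rw [charFun_apply_real, integral_map hf (by fun_prop)]
  have h1 : ∫ ω, inner ℝ t (f ω) ∂P = t * ∫ ω, f ω ∂P := by
    simp only [RCLike.inner_apply, conj_trivial]
    rw [integral_mul_const, mul_comm]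
  have h2 : Var[fun ω ↦ inner ℝ t (f ω); P] = t ^ 2 * (‖f‖ ^ 2 - (∫ ω, f ω ∂P) ^ 2) := by
    simp only [RCLike.inner_apply, conj_trivial]
    rw [← integral_sq_Lp_two]
    simp_rw [mul_comm _ t]
    rw [variance_const_mul, variance_eq_sub (Lp.memLp f)]
    simp
  rw [h1, h2]
  push_cast
  rfl

/-- Characteristic function, mean and norm are all continuous on `L²`, so the Gaussian form of the
characteristic function is a closed condition at each `t`. -/
lemma isClosed_setOf_hasGaussianLaw [IsProbabilityMeasure P] :
    IsClosed {f : Lp ℝ 2 P | HasGaussianLaw f P} := by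
  simp_rw [hasGaussianLaw_iff_integral_exp, Set.ofPred_forall]
  refine isClosed_iInter fun t ↦ isClosed_eq (continuous_integral_exp_Lp_two t) ?_
  have := continuous_integral_Lp_two (P := P)
  fun_prop

/-- The square integrable variables orthogonal to every vector orthogonal to a Gaussian process
are Gaussian. -/
lemma IsGaussianProcess.hasGaussianLaw_of_forall_orthogonal [IsProbabilityMeasure P] {T : Type*}
    {X : T → Ω → ℝ} (hX : IsGaussianProcess X P) {Y : Ω → ℝ} (hY : MemLp Y 2 P)
    (h : ∀ Z : Ω → ℝ, MemLp Z 2 P → (∀ t, ∫ ω, Z ω * X t ω ∂P = 0) → ∫ ω, Z ω * Y ω ∂P = 0) :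
    HasGaussianLaw Y P := by
  have hX2 t : MemLp (X t) 2 P := (hX.hasGaussianLaw_eval t).memLp_two
  set V : T → Lp ℝ 2 P := fun t ↦ (hX2 t).toLp (X t)
  set K : Submodule ℝ (Lp ℝ 2 P) := Submodule.span ℝ (Set.range V)
  have hK : (K : Set (Lp ℝ 2 P)) ⊆ {f | HasGaussianLaw f P} := by
    intro f hf
    obtain ⟨c, rfl⟩ := (Finsupp.mem_span_range_iff_exists_finsupp).1 hf
    have h1 := (hX.smul fun t ↦ c t).hasGaussianLaw_fun_sum (I := c.support)
    refine h1.congr ?_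
    have h2 : ∀ᵐ ω ∂P, ∀ t ∈ c.support, (c t • V t : Lp ℝ 2 P) ω = c t • X t ω := by
      rw [Finset.eventually_all]
      intro t _
      filter_upwards [Lp.coeFn_smul (c t) (V t), (hX2 t).coeFn_toLp] with ω h3 h4
      rw [h3, Pi.smul_apply, h4]
    have h5 : ⇑(c.sum fun i a ↦ a • V i) =ᵐ[P] ∑ t ∈ c.support, ⇑(c t • V t : Lp ℝ 2 P) :=
      Lp.coeFn_finsetSum _ _
    filter_upwards [h2, h5] with ω h2 h5
    rw [h5, Finset.sum_apply]
    exact (Finset.sum_congr rfl h2).symm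
  -- The double orthogonal complement of the span is its closure, so the orthogonality hypothesis is
  -- exactly membership in that closure.
  have hYK : hY.toLp Y ∈ K.topologicalClosure := by
    rw [← Submodule.orthogonal_orthogonal_eq_closure, Submodule.mem_orthogonal]
    intro Z hZ
    rw [Submodule.mem_orthogonal] at hZ
    have key : ∀ W : Ω → ℝ, (hW : MemLp W 2 P) → inner ℝ Z (hW.toLp W) = ∫ ω, Z ω * W ω ∂P := by
      intro W hW
      rw [L2.inner_def]
      refine integral_congr_ae ?_
      filter_upwards [hW.coeFn_toLp] with ω h
      simp [h, mul_comm]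
    rw [key]
    refine h Z (Lp.memLp Z) fun t ↦ ?_
    rw [← key _ (hX2 t), real_inner_comm]
    exact hZ _ (Submodule.subset_span ⟨t, rfl⟩)
  exact HasGaussianLaw.congr (closure_minimal hK isClosed_setOf_hasGaussianLaw hYK) hY.coeFn_toLp

end L2

/-! ### Fourth moments of centred Gaussian variables and pairs. -/

section GaussianMoments

variable {Ω : Type*} [MeasurableSpace Ω] {P : Measure Ω}

lemma integral_pow_four_gaussianReal (v : NNReal) :
    ∫ x, x ^ 4 ∂gaussianReal 0 v = 3 * (v : ℝ) ^ 2 := by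
  have h : ∫ x, x ^ 4 ∂gaussianReal 0 v
      = iteratedDeriv 4 (mgf (fun x ↦ x) (gaussianReal 0 v)) 0 := by
    rw [iteratedDeriv_mgf_zero] <;> simp
  rw [h, mgf_fun_id_gaussianReal]
  simp only [zero_mul, zero_add]
  -- The fourth derivative at `0` of the moment generating function `exp(v t²/2)` is computed one
  -- derivative at a time.
  set e : ℝ → ℝ := fun t ↦ Real.exp (v * t ^ 2 / 2) with he
  have he' t : HasDerivAt e (v * t * e t) t := by
    have := (((hasDerivAt_pow 2 t).const_mul (v : ℝ)).div_const 2).exp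
    refine this.congr_deriv ?_
    simp only [he]
    push_cast
    ring
  have h1 : deriv e = fun t ↦ v * t * e t := funext fun t ↦ (he' t).deriv
  have h2 : deriv (fun t ↦ v * t * e t) = fun t ↦ (v + v ^ 2 * t ^ 2) * e t := by
    funext t
    refine HasDerivAt.deriv ?_
    refine (((hasDerivAt_id t).const_mul (v : ℝ)).mul (he' t)).congr_deriv ?_
    simp only [id]
    ring
  have h3 : deriv (fun t ↦ (v + v ^ 2 * t ^ 2) * e t)
      = fun t ↦ (3 * v ^ 2 * t + v ^ 3 * t ^ 3) * e t := by
    funext t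
    refine HasDerivAt.deriv ?_
    refine ((((hasDerivAt_pow 2 t).const_mul ((v : ℝ) ^ 2)).const_add (v : ℝ)).mul
      (he' t)).congr_deriv ?_
    push_cast
    ring
  have h4 : deriv (fun t ↦ (3 * (v : ℝ) ^ 2 * t + (v : ℝ) ^ 3 * t ^ 3) * e t) 0
      = 3 * (v : ℝ) ^ 2 := by
    refine HasDerivAt.deriv ?_
    refine ((((hasDerivAt_id (0 : ℝ)).const_mul (3 * (v : ℝ) ^ 2)).add
      ((hasDerivAt_pow 3 (0 : ℝ)).const_mul ((v : ℝ) ^ 3))).mul (he' 0)).congr_deriv ?_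
    simp [he]
  rw [iteratedDeriv_succ, iteratedDeriv_succ, iteratedDeriv_succ, iteratedDeriv_one, h1, h2, h3, h4]

lemma HasGaussianLaw.integral_pow_four {X : Ω → ℝ} (hX : HasGaussianLaw X P)
    (h0 : ∫ ω, X ω ∂P = 0) : ∫ ω, X ω ^ 4 ∂P = 3 * (∫ ω, X ω ^ 2 ∂P) ^ 2 := by
  have hv : Var[X; P] = ∫ ω, X ω ^ 2 ∂P := by
    simp [variance_eq_integral hX.aemeasurable, h0]
  have h1 : ∫ ω, X ω ^ 4 ∂P = ∫ x, x ^ 4 ∂(P.map X) :=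
    by
    rw [integral_map hX.aemeasurable (by fun_prop)]
  rw [h1, hX.map_eq_gaussianReal, h0, integral_pow_four_gaussianReal,
    Real.coe_toNNReal _ (variance_nonneg _ _), hv]

lemma HasGaussianLaw.integrable_pow {X : Ω → ℝ} (hX : HasGaussianLaw X P) (n : ℕ) :
    Integrable (fun ω ↦ X ω ^ n) P := by
  have := hX.isProbabilityMeasure
  rcases eq_or_ne n 0 with rfl | hn
  · simp
  · have := (hX.memLp (p := n) (by simp)).integrable_norm_pow hn
    refine this.mono (hX.aemeasurable.pow_const n).aestronglyMeasurable (ae_of_all _ fun ω ↦ ?_)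
    simp

/-- The moment formula `E[X²Y²] = E[X²]E[Y²] + 2 E[XY]²` for centred jointly Gaussian variables. -/
lemma HasGaussianLaw.integral_sq_mul_sq {X Y : Ω → ℝ}
    (hXY : HasGaussianLaw (fun ω ↦ (X ω, Y ω)) P)
    (hX : ∫ ω, X ω ∂P = 0) (hY : ∫ ω, Y ω ∂P = 0) :
    Integrable (fun ω ↦ X ω ^ 2 * Y ω ^ 2) P ∧
    ∫ ω, X ω ^ 2 * Y ω ^ 2 ∂P =
      (∫ ω, X ω ^ 2 ∂P) * (∫ ω, Y ω ^ 2 ∂P) + 2 * (∫ ω, X ω * Y ω ∂P) ^ 2 := by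
  have gX := hXY.fst
  have gY := hXY.snd
  have gS := hXY.fun_add
  have gD := hXY.fun_sub
  have iXY : Integrable (fun ω ↦ X ω * Y ω) P := gX.memLp_two.integrable_mul gY.memLp_two
  have eS0 : ∫ ω, X ω + Y ω ∂P = 0 := by rw [integral_add gX.integrable gY.integrable, hX, hY, add_zero]
  have eD0 : ∫ ω, X ω - Y ω ∂P = 0 := by rw [integral_sub gX.integrable gY.integrable, hX, hY, sub_zero]
  have eS := HasGaussianLaw.integral_pow_four gS eS0
  have eD := HasGaussianLaw.integral_pow_four gD eD0
  have eX := HasGaussianLaw.integral_pow_four gX hX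
  have eY := HasGaussianLaw.integral_pow_four gY hY
  have iX2 := HasGaussianLaw.integrable_pow gX 2
  have iY2 := HasGaussianLaw.integrable_pow gY 2
  have iX4 := HasGaussianLaw.integrable_pow gX 4
  have iY4 := HasGaussianLaw.integrable_pow gY 4
  have iS4 := HasGaussianLaw.integrable_pow gS 4
  have iD4 := HasGaussianLaw.integrable_pow gD 4
  have qS : ∫ ω, (X ω + Y ω) ^ 2 ∂P
      = ∫ ω, X ω ^ 2 ∂P + 2 * ∫ ω, X ω * Y ω ∂P + ∫ ω, Y ω ^ 2 ∂P := by
    rw [← integral_const_mul, ← integral_add iX2 (iXY.const_mul 2), ← integral_add _ iY2]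
    · exact integral_congr_ae (ae_of_all _ fun ω ↦ by ring)
    · exact iX2.add (iXY.const_mul 2)
  have qD : ∫ ω, (X ω - Y ω) ^ 2 ∂P
      = ∫ ω, X ω ^ 2 ∂P - 2 * ∫ ω, X ω * Y ω ∂P + ∫ ω, Y ω ^ 2 ∂P := by
    rw [← integral_const_mul, ← integral_sub iX2 (iXY.const_mul 2), ← integral_add _ iY2]
    · exact integral_congr_ae (ae_of_all _ fun ω ↦ by ring)
    · exact iX2.sub (iXY.const_mul 2)
  -- Polarisation, `12 X²Y² = (X+Y)⁴ + (X-Y)⁴ - 2X⁴ - 2Y⁴`, leaves only fourth moments of single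
  -- Gaussian variables.
  have hid : (fun ω ↦ X ω ^ 2 * Y ω ^ 2) = fun ω ↦ (1 / 12) * (X ω + Y ω) ^ 4
      + (1 / 12) * (X ω - Y ω) ^ 4 - ((1 / 6) * X ω ^ 4 + (1 / 6) * Y ω ^ 4) := by
    funext ω
    ring
  have i1 : Integrable (fun ω ↦ (1 / 12) * (X ω + Y ω) ^ 4 + (1 / 12) * (X ω - Y ω) ^ 4) P :=
    (iS4.const_mul _).add (iD4.const_mul _)
  have i2 : Integrable (fun ω ↦ (1 / 6) * X ω ^ 4 + (1 / 6) * Y ω ^ 4) P :=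
    (iX4.const_mul _).add (iY4.const_mul _)
  rw [hid]
  refine ⟨i1.sub i2, ?_⟩
  rw [integral_sub i1 i2, integral_add (iS4.const_mul _) (iD4.const_mul _),
    integral_add (iX4.const_mul _) (iY4.const_mul _)]
  simp only [integral_const_mul]
  rw [eS, eD, eX, eY, qS, qD]
  ring

lemma HasGaussianLaw.covariance_sq_sq {X Y : Ω → ℝ}
    (hXY : HasGaussianLaw (fun ω ↦ (X ω, Y ω)) P)
    (hX : ∫ ω, X ω ∂P = 0) (hY : ∫ ω, Y ω ∂P = 0) :
    cov[fun ω ↦ X ω ^ 2, fun ω ↦ Y ω ^ 2; P] = 2 * (∫ ω, X ω * Y ω ∂P) ^ 2 := by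
  have := hXY.isProbabilityMeasure
  have m2 {Z : Ω → ℝ} (hZ : HasGaussianLaw Z P) : MemLp (fun ω ↦ Z ω ^ 2) 2 P := by
    rw [memLp_two_iff_integrable_sq (hZ.aemeasurable.pow_const 2).aestronglyMeasurable]
    simpa only [← pow_mul] using HasGaussianLaw.integrable_pow hZ 4
  rw [covariance_eq_sub (m2 hXY.fst) (m2 hXY.snd)]
  have := (HasGaussianLaw.integral_sq_mul_sq hXY hX hY).2
  simp only [Pi.mul_apply]
  rw [this]
  ring

end GaussianMoments

/-! ### Complex Gaussian variables with vanishing pseudo-covariance. -/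

section CircularGaussian

variable {Ω : Type*} [MeasurableSpace Ω] {P : Measure Ω}

lemma integral_re_mul_re_of_integral_mul_eq_zero {Z W : Ω → ℂ} (hZ : MemLp Z 2 P) (hW : MemLp W 2 P)
    (h : ∫ ω, Z ω * W ω ∂P = 0) :
    ∫ ω, (Z ω).re * (W ω).re ∂P = ∫ ω, (Z ω).im * (W ω).im ∂P ∧
    ∫ ω, (Z ω).re * (W ω).im ∂P = - ∫ ω, (Z ω).im * (W ω).re ∂P := by
  have hZr : MemLp (fun ω ↦ (Z ω).re) 2 P := hZ.re
  have hZi : MemLp (fun ω ↦ (Z ω).im) 2 P := hZ.im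
  have hWr : MemLp (fun ω ↦ (W ω).re) 2 P := hW.re
  have hWi : MemLp (fun ω ↦ (W ω).im) 2 P := hW.im
  have i : Integrable (fun ω ↦ Z ω * W ω) P := hZ.integrable_mul hW
  constructor
  · have h1 : ∫ ω, (Z ω * W ω).re ∂P = 0 := by
      have := integral_re i
      simp only [RCLike.re_to_complex] at this
      rw [this, h, Complex.zero_re]
    simp only [Complex.mul_re] at h1
    have i1 : Integrable (fun ω ↦ (Z ω).re * (W ω).re) P := hZr.integrable_mul hWr
    have i2 : Integrable (fun ω ↦ (Z ω).im * (W ω).im) P := hZi.integrable_mul hWi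
    rwa [integral_sub i1 i2, sub_eq_zero] at h1
  · have h1 : ∫ ω, (Z ω * W ω).im ∂P = 0 := by
      have := integral_im i
      simp only [RCLike.im_to_complex] at this
      rw [this, h, Complex.zero_im]
    simp only [Complex.mul_im] at h1
    have i1 : Integrable (fun ω ↦ (Z ω).re * (W ω).im) P := hZr.integrable_mul hWi
    have i2 : Integrable (fun ω ↦ (Z ω).im * (W ω).re) P := hZi.integrable_mul hWr
    rwa [integral_add i1 i2, add_eq_zero_iff_eq_neg] at h1

lemma integral_re_sq_of_integral_sq_eq_zero {Z : Ω → ℂ} (hZ : MemLp Z 2 P)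
    (h : ∫ ω, Z ω * Z ω ∂P = 0) :
    ∫ ω, (Z ω).re ^ 2 ∂P = (∫ ω, ‖Z ω‖ ^ 2 ∂P) / 2 ∧
    ∫ ω, (Z ω).im ^ 2 ∂P = (∫ ω, ‖Z ω‖ ^ 2 ∂P) / 2 ∧
    ∫ ω, (Z ω).re * (Z ω).im ∂P = 0 := by
  obtain ⟨h1, h2⟩ := integral_re_mul_re_of_integral_mul_eq_zero hZ hZ h
  have hZr : MemLp (fun ω ↦ (Z ω).re) 2 P := hZ.re
  have hZi : MemLp (fun ω ↦ (Z ω).im) 2 P := hZ.im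
  have h3 : ∫ ω, ‖Z ω‖ ^ 2 ∂P = ∫ ω, (Z ω).re ^ 2 ∂P + ∫ ω, (Z ω).im ^ 2 ∂P := by
    rw [← integral_add hZr.integrable_sq hZi.integrable_sq]
    refine integral_congr_ae (ae_of_all _ fun ω ↦ ?_)
    simp only
    rw [Complex.sq_norm, Complex.normSq_apply]
    ring
  simp only [← sq] at h1
  simp only [mul_comm (Complex.im _) (Complex.re _)] at h2
  refine ⟨?_, ?_, ?_⟩ <;> linarith

/-- Squaring removes the choice of a branch of the complex square root. The square is all that is
needed, since the real and imaginary parts of a circular variable contribute equal factors. -/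
lemma integral_cexp_sq_gaussianReal {v : NNReal} (hv : v ≠ 0) (t : ℝ) :
    (∫ x, Complex.exp (((t * x ^ 2 : ℝ) : ℂ) * Complex.I) ∂gaussianReal 0 v) ^ 2
      = 1 / (1 - 2 * v * t * Complex.I) := by
  have hv' : (0 : ℝ) < v := by positivity
  set b : ℂ := 1 / (2 * v) - t * Complex.I with hb
  have hbre : 0 < b.re := by
    have : b = ((1 / (2 * v) : ℝ) : ℂ) - t * Complex.I := by rw [hb]; push_cast; rfl
    rw [this]
    simp only [Complex.sub_re, Complex.ofReal_re, Complex.re_ofReal_mul, Complex.I_re, mul_zero, sub_zero]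
    positivity
  have hb0 : b ≠ 0 := fun h ↦ by simp [h] at hbre
  have h1 : ∫ x, Complex.exp (((t * x ^ 2 : ℝ) : ℂ) * Complex.I) ∂gaussianReal 0 v
      = ((√(2 * Real.pi * v))⁻¹ : ℝ) * ∫ x : ℝ, Complex.exp (-b * x ^ 2) := by
    rw [integral_gaussianReal_eq_integral_smul hv, ← integral_const_mul]
    refine integral_congr_ae (ae_of_all _ fun x ↦ ?_)
    simp only [gaussianPDFReal, Complex.real_smul, sub_zero]
    rw [Complex.ofReal_mul, mul_assoc, Complex.ofReal_exp, ← Complex.exp_add]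
    congr 2
    rw [hb]
    push_cast
    have : (v : ℂ) ≠ 0 := by exact_mod_cast hv
    field_simp
    ring
  have h2 : ((Real.pi / b : ℂ) ^ (1 / 2 : ℂ)) ^ 2 = Real.pi / b := by
    rw [← Complex.cpow_nat_mul]
    norm_num
  rw [h1, integral_gaussian_complex hbre, mul_pow, h2, ← Complex.ofReal_pow, inv_pow,
    Real.sq_sqrt (by positivity)]
  have hπ : (Real.pi : ℂ) ≠ 0 := by exact_mod_cast Real.pi_ne_zero
  have hvc : (v : ℂ) ≠ 0 := by exact_mod_cast hv
  have hb2 : 1 - 2 * v * t * Complex.I = 2 * v * b := by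
    rw [hb]
    field_simp
  rw [hb2]
  push_cast
  field_simp

lemma charFun_expMeasure_one (t : ℝ) :
    charFun (expMeasure 1) t = 1 / (1 - t * Complex.I) := by
  rw [charFun_apply_real, expMeasure, gammaMeasure,
    integral_withDensity_eq_integral_toReal_smul₀]
  rotate_left
  · exact (measurable_gammaPDFReal 1 1).ennreal_ofReal.aemeasurable
  · exact ae_of_all _ fun x ↦ ENNReal.ofReal_lt_top
  have h1 : ∀ x : ℝ, (gammaPDF 1 1 x).toReal • Complex.exp (t * x * Complex.I)
      = (Set.Ici (0 : ℝ)).indicator (fun x : ℝ ↦ Complex.exp ((t * Complex.I - 1) * x)) x := by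
    intro x
    by_cases hx : 0 ≤ x
    · rw [Set.indicator_of_mem (Set.mem_Ici.2 hx), gammaPDF_of_nonneg hx, ENNReal.toReal_ofReal (by positivity)]
      simp only [Real.Gamma_one, Real.one_rpow, sub_self, Real.rpow_zero, Complex.real_smul]
      push_cast
      rw [div_one, one_mul, one_mul, one_mul, ← Complex.exp_add]
      ring_nf
    · rw [Set.indicator_of_notMem (by simpa using hx), gammaPDF_of_neg (not_le.1 hx)]
      simp
  simp_rw [h1]
  rw [integral_indicator measurableSet_Ici, integral_Ici_eq_integral_Ioi,
    integral_exp_mul_complex_Ioi (by simp)]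
  have h2 : (1 - t * Complex.I : ℂ) = -(t * Complex.I - 1) := by ring
  rw [h2, div_neg]
  simp [neg_div]

/-- The squared modulus of a circular complex Gaussian variable is exponentially distributed. -/
lemma HasGaussianLaw.hasLaw_sq_norm_div {Z : Ω → ℂ} (hZ : HasGaussianLaw Z P)
    (h0 : ∫ ω, Z ω ∂P = 0) (h2 : ∫ ω, Z ω * Z ω ∂P = 0) {D : ℝ} (hD : 0 < D)
    (hZD : ∫ ω, ‖Z ω‖ ^ 2 ∂P = D) :
    HasLaw (fun ω ↦ ‖Z ω‖ ^ 2 / D) (expMeasure 1) P := by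
  have := hZ.isProbabilityMeasure
  have := isProbabilityMeasure_expMeasure (r := 1) one_pos
  have gXY : HasGaussianLaw (fun ω ↦ ((Z ω).re, (Z ω).im)) P :=
    hZ.map_fun (Complex.reCLM.prod Complex.imCLM)
  have gX := gXY.fst
  have gY := gXY.snd
  obtain ⟨eX, eY, eXY⟩ := integral_re_sq_of_integral_sq_eq_zero hZ.memLp_two h2
  have mX : ∫ ω, (Z ω).re ∂P = 0 := by
    have := integral_re hZ.integrable
    simp only [RCLike.re_to_complex] at this
    rw [this, h0, Complex.zero_re]
  have mY : ∫ ω, (Z ω).im ∂P = 0 := by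
    have := integral_im hZ.integrable
    simp only [RCLike.im_to_complex] at this
    rw [this, h0, Complex.zero_im]
  -- Jointly Gaussian and uncorrelated, hence independent; the characteristic function of the
  -- squared modulus therefore factors.
  have hind : IndepFun (fun ω ↦ (Z ω).re) (fun ω ↦ (Z ω).im) P := by
    refine gXY.indepFun_of_covariance_eq_zero ?_
    rw [covariance_eq_sub gX.memLp_two gY.memLp_two, mX, zero_mul, sub_zero]
    exact eXY
  set v : NNReal := (D / 2).toNNReal with hv
  have hv0 : v ≠ 0 := (Real.toNNReal_pos.2 (by positivity)).ne'
  have hvD : (v : ℝ) = D / 2 := Real.coe_toNNReal _ (by positivity)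
  have lX : P.map (fun ω ↦ (Z ω).re) = gaussianReal 0 v := by
    rw [gX.map_eq_gaussianReal, mX, variance_of_integral_eq_zero gX.aemeasurable mX, eX, hZD]
  have lY : P.map (fun ω ↦ (Z ω).im) = gaussianReal 0 v := by
    rw [gY.map_eq_gaussianReal, mY, variance_of_integral_eq_zero gY.aemeasurable mY, eY, hZD]
  have hm : AEMeasurable (fun ω ↦ ‖Z ω‖ ^ 2 / D) P := (hZ.aemeasurable.norm.pow_const 2).div_const D
  refine ⟨hm, ?_⟩
  have := Measure.isProbabilityMeasure_map hm
  refine Measure.ext_of_charFun (funext fun t ↦ ?_)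
  rw [charFun_expMeasure_one, charFun_apply_real, integral_map hm (by fun_prop)]
  set φ : ℝ → ℂ := fun x ↦ Complex.exp (((t / D * x ^ 2 : ℝ) : ℂ) * Complex.I) with hφ
  have hφm : Measurable φ := by fun_prop
  have e1 : ∀ ω, Complex.exp (t * ((‖Z ω‖ ^ 2 / D : ℝ) : ℂ) * Complex.I)
      = φ (Z ω).re * φ (Z ω).im := by
    intro ω
    rw [Complex.sq_norm, Complex.normSq_apply]
    simp only [hφ]
    rw [← Complex.exp_add]
    congr 1
    push_cast
    ring
  simp_rw [e1]
  have e2 := (hind.comp hφm hφm).integral_fun_mul_eq_mul_integral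
    (hφm.comp_aemeasurable gX.aemeasurable).aestronglyMeasurable
    (hφm.comp_aemeasurable gY.aemeasurable).aestronglyMeasurable
  simp only [Function.comp_apply] at e2
  rw [e2, ← integral_map gX.aemeasurable hφm.aestronglyMeasurable,
    ← integral_map gY.aemeasurable hφm.aestronglyMeasurable, lX, lY, ← sq,
    integral_cexp_sq_gaussianReal hv0, show (v : ℂ) = ((v : ℝ) : ℂ) from rfl, hvD]
  congr 2
  push_cast
  have : (D : ℂ) ≠ 0 := by exact_mod_cast hD.ne'
  field_simp

/-- Covariance of the squared moduli of jointly Gaussian, jointly circular centred variables. -/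
lemma HasGaussianLaw.covariance_sq_norm {Z W : Ω → ℂ}
    (hZW : HasGaussianLaw (fun ω ↦ (Z ω, W ω)) P)
    (hZ : ∫ ω, Z ω ∂P = 0) (hW : ∫ ω, W ω ∂P = 0) (h : ∫ ω, Z ω * W ω ∂P = 0) :
    cov[fun ω ↦ ‖Z ω‖ ^ 2, fun ω ↦ ‖W ω‖ ^ 2; P] =
      4 * (∫ ω, (Z ω).re * (W ω).re ∂P) ^ 2 + 4 * (∫ ω, (Z ω).re * (W ω).im ∂P) ^ 2 := by
  have := hZW.isProbabilityMeasure
  have gZ := hZW.fst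
  have gW := hZW.snd
  have m {V : Ω → ℂ} (gV : HasGaussianLaw V P) (hV : ∫ ω, V ω ∂P = 0) :
      ∫ ω, (V ω).re ∂P = 0 ∧ ∫ ω, (V ω).im ∂P = 0 := by
    have h1 := integral_re gV.integrable
    have h2 := integral_im gV.integrable
    simp only [RCLike.re_to_complex, RCLike.im_to_complex] at h1 h2
    rw [h1, h2, hV]
    simp
  obtain ⟨mZr, mZi⟩ := m gZ hZ
  obtain ⟨mWr, mWi⟩ := m gW hW
  have gL (L M : ℂ →L[ℝ] ℝ) : HasGaussianLaw (fun ω ↦ (L (Z ω), M (W ω))) P :=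
    hZW.map_fun (L.prodMap M)
  have m2 {X : Ω → ℝ} (hX : HasGaussianLaw X P) : MemLp (fun ω ↦ X ω ^ 2) 2 P := by
    rw [memLp_two_iff_integrable_sq (hX.aemeasurable.pow_const 2).aestronglyMeasurable]
    simpa only [← pow_mul] using HasGaussianLaw.integrable_pow hX 4
  have crr := HasGaussianLaw.covariance_sq_sq (gL Complex.reCLM Complex.reCLM) mZr mWr
  have cri := HasGaussianLaw.covariance_sq_sq (gL Complex.reCLM Complex.imCLM) mZr mWi
  have cir := HasGaussianLaw.covariance_sq_sq (gL Complex.imCLM Complex.reCLM) mZi mWr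
  have cii := HasGaussianLaw.covariance_sq_sq (gL Complex.imCLM Complex.imCLM) mZi mWi
  simp only [Complex.reCLM_apply, Complex.imCLM_apply] at crr cri cir cii
  obtain ⟨h1, h2⟩ := integral_re_mul_re_of_integral_mul_eq_zero gZ.memLp_two gW.memLp_two h
  have e (V : Ω → ℂ) : (fun ω ↦ ‖V ω‖ ^ 2)
      = (fun ω ↦ (V ω).re ^ 2) + (fun ω ↦ (V ω).im ^ 2) := by
    funext ω
    rw [Pi.add_apply, Complex.sq_norm, Complex.normSq_apply]
    ring
  have qZr := m2 (gZ.map_fun Complex.reCLM)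
  have qZi := m2 (gZ.map_fun Complex.imCLM)
  have qWr := m2 (gW.map_fun Complex.reCLM)
  have qWi := m2 (gW.map_fun Complex.imCLM)
  simp only [Complex.reCLM_apply, Complex.imCLM_apply] at qZr qZi qWr qWi
  -- Of the four covariances of squares, `h1` and `h2` make re-re equal to im-im and re-im equal to
  -- im-re, which turns each factor `2` into `4`.
  rw [e, e, covariance_add_left qZr qZi (qWr.add qWi), covariance_add_right qZr qWr qWi,
    covariance_add_right qZi qWr qWi, crr, cri, cir, cii, ← h1, h2]
  ring

end CircularGaussian

/-! ### The angular Fourier transform and its injectivity. -/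

section Fourier

lemma norm_exp_neg_I_mul (t ω : ℝ) : ‖Complex.exp (-(Complex.I * t * ω))‖ = 1 := by
  rw [show -(Complex.I * t * ω) = ((-(t * ω) : ℝ) : ℂ) * Complex.I by push_cast; ring]
  exact Complex.norm_exp_ofReal_mul_I _

lemma integrable_exp_neg_I_mul {f : ℝ → ℂ} (hf : Integrable f) (ω : ℝ) :
    Integrable (fun t : ℝ ↦ Complex.exp (-(Complex.I * t * ω)) * f t) := by
  refine hf.mono (by fun_prop) (ae_of_all _ fun t ↦ ?_)
  rw [norm_mul, norm_exp_neg_I_mul, one_mul]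

lemma angularFourier_zero_right (f : ℝ → ℂ) : angularFourier f 0 = ∫ t, f t := by
  simp [angularFourier]

lemma angularFourier_add {f g : ℝ → ℂ} (hf : Integrable f) (hg : Integrable g) (ω : ℝ) :
    angularFourier (f + g) ω = angularFourier f ω + angularFourier g ω := by
  simp only [angularFourier, Pi.add_apply, mul_add]
  exact integral_add (integrable_exp_neg_I_mul hf ω) (integrable_exp_neg_I_mul hg ω)

lemma angularFourier_smul (c : ℂ) (f : ℝ → ℂ) (ω : ℝ) :
    angularFourier (c • f) ω = c * angularFourier f ω := by
  simp only [angularFourier, Pi.smul_apply, smul_eq_mul, mul_left_comm _ c]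
  exact integral_const_mul _ _

lemma angularFourier_sub {f g : ℝ → ℂ} (hf : Integrable f) (hg : Integrable g) (ω : ℝ) :
    angularFourier (f - g) ω = angularFourier f ω - angularFourier g ω := by
  simp only [angularFourier, Pi.sub_apply, mul_sub]
  exact integral_sub (integrable_exp_neg_I_mul hf ω) (integrable_exp_neg_I_mul hg ω)

lemma angularFourier_conj (f : ℝ → ℂ) (ω : ℝ) :
    angularFourier (fun t ↦ conj (f t)) ω = conj (angularFourier f (-ω)) := by
  simp only [angularFourier]
  rw [← integral_conj]
  congr 1 with t
  rw [map_mul, ← Complex.exp_conj]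
  simp

lemma continuous_angularFourier {f : ℝ → ℂ} (hf : Integrable f) : Continuous (angularFourier f) := by
  refine continuous_of_dominated (bound := fun t ↦ ‖f t‖) (fun ω ↦ ?_) (fun ω ↦ ?_) hf.norm ?_
  · exact (integrable_exp_neg_I_mul hf ω).aestronglyMeasurable
  · exact ae_of_all _ fun t ↦ by rw [norm_mul, norm_exp_neg_I_mul, one_mul]
  · exact ae_of_all _ fun t ↦ by fun_prop

open scoped FourierTransform in
lemma fourier_eq_angularFourier (f : ℝ → ℂ) (ξ : ℝ) :
    𝓕 f ξ = angularFourier f (2 * Real.pi * ξ) := by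
  rw [Real.fourier_real_eq_integral_exp_smul, angularFourier]
  congr 1 with t
  rw [smul_eq_mul]
  congr 2
  push_cast
  ring

open scoped FourierTransform SchwartzMap in
-- A test function `g` is the Fourier transform of a Schwartz function `φ`, so `∫ g f = ∫ φ f̂ = 0`.
lemma ae_eq_zero_of_angularFourier_eq_zero {f : ℝ → ℂ} (hf : Integrable f)
    (h : ∀ ω, angularFourier f ω = 0) : f =ᵐ[volume] 0 := by
  refine ae_eq_zero_of_integral_contDiff_smul_eq_zero hf.locallyIntegrable fun g hg hgc ↦ ?_
  have hgc' : HasCompactSupport (Complex.ofReal ∘ g) := hgc.comp_left rfl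
  have hg' : ContDiff ℝ ((⊤ : ℕ∞) : WithTop ℕ∞) (Complex.ofReal ∘ g) :=
    Complex.ofRealCLM.contDiff.comp hg
  set G : 𝓢(ℝ, ℂ) := hgc'.toSchwartzMap hg'
  obtain ⟨φ, hφ⟩ : ∃ φ : 𝓢(ℝ, ℂ), 𝓕 φ = G := ⟨𝓕⁻ G, by simp⟩
  have key := VectorFourier.integral_fourierIntegral_smul_eq_flip (L := innerₗ ℝ) (μ := volume)
    (ν := volume) (f := φ) (g := f) Real.continuous_fourierChar continuous_inner φ.integrable hf
  have h1 : ∀ ξ, VectorFourier.fourierIntegral Real.fourierChar volume (innerₗ ℝ).flip f ξ = 0 := by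
    intro ξ
    have := fourier_eq_angularFourier f ξ
    rw [h] at this
    rw [flip_innerₗ]
    exact this
  have h2 : ∀ ξ, VectorFourier.fourierIntegral Real.fourierChar volume (innerₗ ℝ) φ ξ = (g ξ : ℂ) := by
    intro ξ
    have : (𝓕 φ : 𝓢(ℝ, ℂ)) ξ = g ξ := by rw [hφ]; rfl
    rw [← this, SchwartzMap.fourier_coe]
    rfl
  simp only [h1, h2, smul_zero, integral_zero] at key
  simpa using key

end Fourier

/-! ### Pathwise integrals against a kernel. -/

section KernelIntegral

variable {Ω : Type*}

/-- The integral of a random process against the kernel `h`, taken path by path. -/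
noncomputable def kernelIntegral (Φ : ℝ → Ω → ℝ) (h : ℝ → ℂ) (ω : Ω) : ℂ :=
  ∫ τ : ℝ, (Φ τ ω : ℂ) * h τ

lemma kernelIntegral_mul_kernelIntegral (Φ : ℝ → Ω → ℝ) (f g : ℝ → ℂ) (ω : Ω) :
    kernelIntegral Φ f ω * kernelIntegral Φ g ω =
      ∫ z : ℝ × ℝ, ((Φ z.1 ω : ℂ) * f z.1) * ((Φ z.2 ω : ℂ) * g z.2) ∂(volume.prod volume) :=
  (integral_prod_mul _ _).symm

lemma kernelIntegral_smul (Φ : ℝ → Ω → ℝ) (c : ℂ) (h : ℝ → ℂ) (ω : Ω) :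
    kernelIntegral Φ (c • h) ω = c * kernelIntegral Φ h ω := by
  simp only [kernelIntegral, Pi.smul_apply, smul_eq_mul, mul_left_comm _ c]
  exact integral_const_mul _ _

lemma conj_kernelIntegral (Φ : ℝ → Ω → ℝ) (h : ℝ → ℂ) (ω : Ω) :
    conj (kernelIntegral Φ h ω) = kernelIntegral Φ (fun τ ↦ conj (h τ)) ω := by
  simp only [kernelIntegral]
  rw [← integral_conj]
  simp

end KernelIntegral

/-! ### Moments and Gaussianity of kernel integrals of the noise. -/

section Noise

variable {Ω : Type*} [MeasurableSpace Ω] {P : Measure Ω} {Φ : ℝ → Ω → ℝ} {p : ℝ → ℝ}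

namespace IsStationaryGaussianNoise

lemma memLp_two (hΦ : IsStationaryGaussianNoise Φ P p) (t : ℝ) : MemLp (Φ t) 2 P :=
  (hΦ.gaussian.hasGaussianLaw_eval t).memLp_two

lemma integral_eval_eq (hΦ : IsStationaryGaussianNoise Φ P p) (t : ℝ) :
    ∫ ω, Φ t ω ∂P = ∫ ω, Φ 0 ω ∂P := by
  have := ((hΦ.stationary t).comp (u := fun x : ℝ → ℝ ↦ x 0) (measurable_pi_apply 0)).integral_eq
  simpa [Function.comp_def] using this

lemma integral_mul_eval_eq (hΦ : IsStationaryGaussianNoise Φ P p) (a b : ℝ) :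
    ∫ ω, Φ a ω * Φ b ω ∂P = ∫ ω, Φ (a - b) ω * Φ 0 ω ∂P := by
  have := ((hΦ.stationary b).comp (u := fun x : ℝ → ℝ ↦ x (a - b) * x 0)
    ((measurable_pi_apply (a - b)).mul (measurable_pi_apply (0 : ℝ)))).integral_eq
  simpa [Function.comp_def] using this

lemma integral_mul_eval_eq_integral_exp [IsProbabilityMeasure P]
    (hΦ : IsStationaryGaussianNoise Φ P p) (a b : ℝ) :
    ((∫ ω, Φ a ω * Φ b ω ∂P : ℝ) : ℂ) =
      (∫ ξ : ℝ, Complex.exp (Complex.I * (a - b : ℝ) * ξ) * (p ξ : ℂ))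
        + ((∫ ω, Φ 0 ω ∂P : ℝ) : ℂ) ^ 2 := by
  have h1 := covariance_eq_sub (hΦ.memLp_two (a - b)) (hΦ.memLp_two 0)
  rw [hΦ.integral_eval_eq (a - b)] at h1
  simp only [Pi.mul_apply] at h1
  rw [← hΦ.covariance_eq, hΦ.integral_mul_eval_eq, h1]
  push_cast
  ring

lemma integral_sq_eval_eq (hΦ : IsStationaryGaussianNoise Φ P p) (t : ℝ) :
    ∫ ω, Φ t ω ^ 2 ∂P = ∫ ω, Φ 0 ω ^ 2 ∂P := by
  have := hΦ.integral_mul_eval_eq t t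
  simpa only [sub_self, ← sq] using this

lemma aestronglyMeasurable_prod (hΦ : IsStationaryGaussianNoise Φ P p) {h : ℝ → ℂ}
    (hh : Integrable h) :
    AEStronglyMeasurable (fun z : ℝ × Ω ↦ (Φ z.1 z.2 : ℂ) * h z.1) (volume.prod P) := by
  have h1 : Measurable fun z : ℝ × Ω ↦ (Φ z.1 z.2 : ℂ) :=
    Complex.measurable_ofReal.comp hΦ.measurable
  exact h1.aestronglyMeasurable.mul hh.aestronglyMeasurable.comp_fst

/-- The bound does not depend on `t`; this uniformity makes Fubini available for every integrable
kernel. -/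
lemma integral_abs_mul_le [IsProbabilityMeasure P] (hΦ : IsStationaryGaussianNoise Φ P p)
    {Z : Ω → ℝ} (hZ : MemLp Z 2 P) (t : ℝ) :
    ∫ ω, |Z ω * Φ t ω| ∂P ≤ ∫ ω, Z ω ^ 2 ∂P + ∫ ω, Φ 0 ω ^ 2 ∂P := by
  rw [← hΦ.integral_sq_eval_eq t, ← integral_add hZ.integrable_sq (hΦ.memLp_two t).integrable_sq]
  refine integral_mono (hZ.integrable_mul (hΦ.memLp_two t)).abs
    (hZ.integrable_sq.add (hΦ.memLp_two t).integrable_sq) fun ω ↦ ?_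
  rw [abs_le]
  constructor <;> nlinarith [sq_nonneg (Z ω - Φ t ω), sq_nonneg (Z ω + Φ t ω),
    sq_nonneg (Z ω), sq_nonneg (Φ t ω)]

/-- Joint integrability of `Z(ω) Φ(τ, ω) h(τ)` for square integrable `Z`. -/
lemma integrable_mul_prod [IsProbabilityMeasure P] (hΦ : IsStationaryGaussianNoise Φ P p)
    {Z : Ω → ℝ} (hZ : MemLp Z 2 P) {h : ℝ → ℂ} (hh : Integrable h) :
    Integrable (fun z : ℝ × Ω ↦ (Z z.2 : ℂ) * ((Φ z.1 z.2 : ℂ) * h z.1)) (volume.prod P) := by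
  have hm : AEStronglyMeasurable (fun z : ℝ × Ω ↦ (Z z.2 : ℂ) * ((Φ z.1 z.2 : ℂ) * h z.1))
      (volume.prod P) :=
    (Complex.continuous_ofReal.comp_aestronglyMeasurable hZ.aestronglyMeasurable.comp_snd).mul
      (hΦ.aestronglyMeasurable_prod hh)
  refine (integrable_prod_iff hm).2 ⟨ae_of_all _ fun t ↦ ?_, ?_⟩
  · have := ((hZ.integrable_mul (hΦ.memLp_two t)).ofReal (𝕜 := ℂ)).mul_const (h t)
    refine this.congr (ae_of_all _ fun ω ↦ ?_)
    simp [mul_assoc]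
  · refine Integrable.mono' (hh.norm.const_mul (∫ ω, Z ω ^ 2 ∂P + ∫ ω, Φ 0 ω ^ 2 ∂P))
      hm.norm.integral_prod_right' (ae_of_all _ fun t ↦ ?_)
    rw [Real.norm_of_nonneg (integral_nonneg fun _ ↦ norm_nonneg _)]
    have h1 : ∀ ω, ‖(Z ω : ℂ) * ((Φ t ω : ℂ) * h t)‖ = |Z ω * Φ t ω| * ‖h t‖ := by
      intro ω
      rw [norm_mul, norm_mul, Complex.norm_real, Complex.norm_real, abs_mul, ← mul_assoc]
      rfl
    simp only [h1]
    rw [integral_mul_const]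
    gcongr
    exact hΦ.integral_abs_mul_le hZ t

lemma integrable_prod [IsProbabilityMeasure P] (hΦ : IsStationaryGaussianNoise Φ P p)
    {h : ℝ → ℂ} (hh : Integrable h) :
    Integrable (fun z : ℝ × Ω ↦ (Φ z.1 z.2 : ℂ) * h z.1) (volume.prod P) := by
  simpa using hΦ.integrable_mul_prod (memLp_const (1 : ℝ)) hh

lemma ae_integrable_mul [IsProbabilityMeasure P] (hΦ : IsStationaryGaussianNoise Φ P p)
    {h : ℝ → ℂ} (hh : Integrable h) : ∀ᵐ ω ∂P, Integrable fun τ ↦ (Φ τ ω : ℂ) * h τ :=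
  (hΦ.integrable_prod hh).prod_left_ae

lemma integrable_kernelIntegral [IsProbabilityMeasure P] (hΦ : IsStationaryGaussianNoise Φ P p)
    {h : ℝ → ℂ} (hh : Integrable h) : Integrable (kernelIntegral Φ h) P :=
  (hΦ.integrable_prod hh).integral_prod_right

lemma integral_kernelIntegral [IsProbabilityMeasure P] (hΦ : IsStationaryGaussianNoise Φ P p)
    {h : ℝ → ℂ} (hh : Integrable h) :
    ∫ ω, kernelIntegral Φ h ω ∂P = ((∫ ω, Φ 0 ω ∂P : ℝ) : ℂ) * ∫ τ, h τ := by
  simp only [kernelIntegral]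
  rw [← integral_integral_swap (f := fun τ ω ↦ (Φ τ ω : ℂ) * h τ) (hΦ.integrable_prod hh),
    ← integral_const_mul]
  refine integral_congr_ae (ae_of_all _ fun τ ↦ ?_)
  simp only
  rw [integral_mul_const, integral_complex_ofReal, hΦ.integral_eval_eq]

/-- Joint integrability of `Φ(a, ω) f(a) Φ(b, ω) g(b)`. -/
lemma integrable_prod_prod [IsProbabilityMeasure P] (hΦ : IsStationaryGaussianNoise Φ P p)
    {f g : ℝ → ℂ} (hf : Integrable f) (hg : Integrable g) :
    Integrable (fun z : (ℝ × ℝ) × Ω ↦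
      ((Φ z.1.1 z.2 : ℂ) * f z.1.1) * ((Φ z.1.2 z.2 : ℂ) * g z.1.2))
      ((volume.prod volume).prod P) := by
  have hΦ1 : Measurable fun z : (ℝ × ℝ) × Ω ↦ (Φ z.1.1 z.2 : ℂ) :=
    Complex.measurable_ofReal.comp (hΦ.measurable.comp (by fun_prop : Measurable
      fun z : (ℝ × ℝ) × Ω ↦ (z.1.1, z.2)))
  have hΦ2 : Measurable fun z : (ℝ × ℝ) × Ω ↦ (Φ z.1.2 z.2 : ℂ) :=
    Complex.measurable_ofReal.comp (hΦ.measurable.comp (by fun_prop : Measurable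
      fun z : (ℝ × ℝ) × Ω ↦ (z.1.2, z.2)))
  have hm : AEStronglyMeasurable (fun z : (ℝ × ℝ) × Ω ↦
      ((Φ z.1.1 z.2 : ℂ) * f z.1.1) * ((Φ z.1.2 z.2 : ℂ) * g z.1.2))
      ((volume.prod volume).prod P) :=
    (hΦ1.aestronglyMeasurable.mul hf.aestronglyMeasurable.comp_fst.comp_fst).mul
      (hΦ2.aestronglyMeasurable.mul hg.aestronglyMeasurable.comp_snd.comp_fst)
  refine (integrable_prod_iff hm).2 ⟨ae_of_all _ fun z ↦ ?_, ?_⟩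
  · have := (((hΦ.memLp_two z.1).integrable_mul (hΦ.memLp_two z.2)).ofReal (𝕜 := ℂ)).mul_const
      (f z.1 * g z.2)
    refine this.congr (ae_of_all _ fun ω ↦ ?_)
    simp only [Pi.mul_apply, RCLike.ofReal_alg, Complex.real_smul, mul_one]
    push_cast
    ring
  · refine Integrable.mono' ((hf.mul_prod hg).norm.const_mul
      (∫ ω, Φ 0 ω ^ 2 ∂P + ∫ ω, Φ 0 ω ^ 2 ∂P))
      hm.norm.integral_prod_right' (ae_of_all _ fun z ↦ ?_)
    rw [Real.norm_of_nonneg (integral_nonneg fun _ ↦ norm_nonneg _)]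
    have h1 : ∀ ω, ‖((Φ z.1 ω : ℂ) * f z.1) * ((Φ z.2 ω : ℂ) * g z.2)‖
        = |Φ z.1 ω * Φ z.2 ω| * ‖f z.1 * g z.2‖ := by
      intro ω
      simp only [norm_mul, Complex.norm_real, abs_mul, Real.norm_eq_abs]
      ring
    simp only [h1]
    rw [integral_mul_const]
    gcongr
    have := hΦ.integral_abs_mul_le (hΦ.memLp_two z.1) z.2
    rwa [hΦ.integral_sq_eval_eq z.1] at this

lemma integrable_kernelIntegral_mul [IsProbabilityMeasure P]
    (hΦ : IsStationaryGaussianNoise Φ P p) {f g : ℝ → ℂ} (hf : Integrable f) (hg : Integrable g) :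
    Integrable (fun ω ↦ kernelIntegral Φ f ω * kernelIntegral Φ g ω) P := by
  simp only [kernelIntegral_mul_kernelIntegral]
  exact (hΦ.integrable_prod_prod hf hg).integral_prod_right

lemma memLp_kernelIntegral [IsProbabilityMeasure P] (hΦ : IsStationaryGaussianNoise Φ P p)
    {h : ℝ → ℂ} (hh : Integrable h) : MemLp (kernelIntegral Φ h) 2 P := by
  rw [memLp_two_iff_integrable_sq_norm (hΦ.integrable_kernelIntegral hh).aestronglyMeasurable]
  simpa [sq] using (hΦ.integrable_kernelIntegral_mul hh hh).norm

/-- The spectral representation of the second moments of integrals of the noise against a pair of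
kernels the first of which has zero mean. -/
lemma integral_kernelIntegral_mul [IsProbabilityMeasure P]
    (hΦ : IsStationaryGaussianNoise Φ P p) {f g : ℝ → ℂ} (hf : Integrable f) (hg : Integrable g)
    (hf0 : ∫ τ, f τ = 0) :
    ∫ ω, kernelIntegral Φ f ω * kernelIntegral Φ g ω ∂P =
      ∫ ξ : ℝ, (p ξ : ℂ) * (angularFourier f (-ξ) * angularFourier g ξ) := by
  have hfg : Integrable (fun z : ℝ × ℝ ↦ f z.1 * g z.2) (volume.prod volume) := hf.mul_prod hg
  have i3 : Integrable (fun w : (ℝ × ℝ) × ℝ ↦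
      Complex.exp (Complex.I * (w.1.1 - w.1.2 : ℝ) * w.2) * ((f w.1.1 * g w.1.2) * (p w.2 : ℂ)))
      ((volume.prod volume).prod volume) := by
    have h1 := hfg.mul_prod (hΦ.density_integrable.ofReal (𝕜 := ℂ))
    refine h1.mono ((by fun_prop : Continuous fun w : (ℝ × ℝ) × ℝ ↦
      Complex.exp (Complex.I * (w.1.1 - w.1.2 : ℝ) * w.2)).aestronglyMeasurable.mul
        h1.aestronglyMeasurable) (ae_of_all _ fun w ↦ ?_)
    rw [norm_mul, mul_assoc, mul_comm Complex.I, ← Complex.ofReal_mul,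
      Complex.norm_exp_ofReal_mul_I, one_mul]
    rfl
  simp only [kernelIntegral_mul_kernelIntegral]
  rw [← integral_integral_swap (f := fun (z : ℝ × ℝ) ω ↦
    ((Φ z.1 ω : ℂ) * f z.1) * ((Φ z.2 ω : ℂ) * g z.2)) (hΦ.integrable_prod_prod hf hg)]
  have h1 : ∀ z : ℝ × ℝ, ∫ ω, ((Φ z.1 ω : ℂ) * f z.1) * ((Φ z.2 ω : ℂ) * g z.2) ∂P
      = (∫ ξ : ℝ, Complex.exp (Complex.I * (z.1 - z.2 : ℝ) * ξ) * ((f z.1 * g z.2) * (p ξ : ℂ)))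
        + ((∫ ω, Φ 0 ω ∂P : ℝ) : ℂ) ^ 2 * (f z.1 * g z.2) := by
    intro z
    have h2 : ∫ ω, ((Φ z.1 ω : ℂ) * f z.1) * ((Φ z.2 ω : ℂ) * g z.2) ∂P
        = ((∫ ω, Φ z.1 ω * Φ z.2 ω ∂P : ℝ) : ℂ) * (f z.1 * g z.2) := by
      rw [← integral_complex_ofReal, ← integral_mul_const]
      congr 1 with ω
      push_cast
      ring
    rw [h2, hΦ.integral_mul_eval_eq_integral_exp, add_mul, ← integral_mul_const]
    congr 2 with ξ
    ring
  simp only [h1]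
  -- The arbitrary mean of `Φ` enters only through `(E Φ(0))² ∫f ∫g`, which `hf0` removes.
  rw [integral_add i3.integral_prod_left (hfg.const_mul _), integral_const_mul,
    integral_prod_mul, hf0, zero_mul, mul_zero, add_zero,
    integral_integral_swap (f := fun (z : ℝ × ℝ) (ξ : ℝ) ↦
      Complex.exp (Complex.I * (z.1 - z.2 : ℝ) * ξ) * ((f z.1 * g z.2) * (p ξ : ℂ))) i3]
  congr 1 with ξ
  simp only [angularFourier]
  rw [← integral_prod_mul, ← integral_const_mul]
  congr 1 with z
  have : Complex.exp (Complex.I * (z.1 - z.2 : ℝ) * ξ)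
      = Complex.exp (-(Complex.I * z.1 * (-ξ : ℝ))) * Complex.exp (-(Complex.I * z.2 * ξ)) := by
    rw [← Complex.exp_add]
    congr 1
    push_cast
    ring
  rw [this]
  ring

lemma integral_kernelIntegral_mul_left [IsProbabilityMeasure P]
    (hΦ : IsStationaryGaussianNoise Φ P p) {Z : Ω → ℝ} (hZ : MemLp Z 2 P)
    {h : ℝ → ℂ} (hh : Integrable h) :
    ∫ ω, (Z ω : ℂ) * kernelIntegral Φ h ω ∂P = ∫ τ, ((∫ ω, Z ω * Φ τ ω ∂P : ℝ) : ℂ) * h τ := by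
  simp only [kernelIntegral, ← integral_const_mul]
  rw [← integral_integral_swap (f := fun τ ω ↦ (Z ω : ℂ) * ((Φ τ ω : ℂ) * h τ))
    (hΦ.integrable_mul_prod hZ hh)]
  congr 1 with τ
  rw [← integral_complex_ofReal, ← integral_mul_const]
  congr 1 with ω
  push_cast
  ring

/-- If `Z` is orthogonal to every `Φ τ`, Fubini moves the expectation inside the `τ`-integral and
`Z` is orthogonal to the kernel integral too. -/
lemma hasGaussianLaw_re_kernelIntegral [IsProbabilityMeasure P]
    (hΦ : IsStationaryGaussianNoise Φ P p) {h : ℝ → ℂ} (hh : Integrable h) :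
    HasGaussianLaw (fun ω ↦ (kernelIntegral Φ h ω).re) P := by
  refine IsGaussianProcess.hasGaussianLaw_of_forall_orthogonal hΦ.gaussian
    (hΦ.memLp_kernelIntegral hh).re fun Z hZ h0 ↦ ?_
  have h1 := hΦ.integral_kernelIntegral_mul_left hZ hh
  simp only [h0, Complex.ofReal_zero, zero_mul, integral_zero] at h1
  have h2 : Integrable (fun ω ↦ (Z ω : ℂ) * kernelIntegral Φ h ω) P :=
    hZ.ofReal.integrable_mul (hΦ.memLp_kernelIntegral hh)
  have h3 := integral_re h2
  simp only [RCLike.re_to_complex, Complex.re_ofReal_mul] at h3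
  rw [h1] at h3
  exact h3

lemma kernelIntegral_sub_ae [IsProbabilityMeasure P] (hΦ : IsStationaryGaussianNoise Φ P p)
    {f g : ℝ → ℂ} (hf : Integrable f) (hg : Integrable g) :
    kernelIntegral Φ (f - g) =ᵐ[P] kernelIntegral Φ f - kernelIntegral Φ g := by
  filter_upwards [hΦ.ae_integrable_mul hf, hΦ.ae_integrable_mul hg] with ω h1 h2
  simp only [kernelIntegral, Pi.sub_apply, mul_sub]
  exact integral_sub h1 h2

lemma kernelIntegral_sum_ae [IsProbabilityMeasure P] (hΦ : IsStationaryGaussianNoise Φ P p)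
    {ι : Type*} [Fintype ι] (c : ι → ℂ) {h : ι → ℝ → ℂ} (hh : ∀ k, Integrable (h k)) :
    kernelIntegral Φ (∑ k, c k • h k) =ᵐ[P] fun ω ↦ ∑ k, c k * kernelIntegral Φ (h k) ω := by
  filter_upwards [ae_all_iff.2 fun k ↦ hΦ.ae_integrable_mul (hh k)] with ω h1
  simp only [← kernelIntegral_smul]
  simp only [kernelIntegral, Finset.sum_apply, Finset.mul_sum]
  refine integral_finsetSum _ fun k _ ↦ ?_
  refine ((h1 k).const_mul (c k)).congr (ae_of_all _ fun τ ↦ ?_)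
  simp only [Pi.smul_apply, smul_eq_mul]
  ring

end IsStationaryGaussianNoise

end Noise

/-! ### Antianalytic kernels and the wavelet kernel. -/

section AntianalyticKernel

/-- An integrable kernel whose Fourier transform vanishes on `[0, ∞)`. -/
structure IsAntianalyticKernel (h : ℝ → ℂ) : Prop where
  integrable : Integrable h
  antianalytic : ∀ ω : ℝ, 0 ≤ ω → angularFourier h ω = 0

namespace IsAntianalyticKernel

variable {f g : ℝ → ℂ}

lemma zero : IsAntianalyticKernel 0 :=
  ⟨integrable_zero _ _ _, fun ω _ ↦ by simp [angularFourier]⟩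

lemma add (hf : IsAntianalyticKernel f) (hg : IsAntianalyticKernel g) :
    IsAntianalyticKernel (f + g) :=
  ⟨hf.integrable.add hg.integrable, fun ω hω ↦ by
    rw [angularFourier_add hf.integrable hg.integrable, hf.antianalytic ω hω,
      hg.antianalytic ω hω, add_zero]⟩

lemma sub (hf : IsAntianalyticKernel f) (hg : IsAntianalyticKernel g) :
    IsAntianalyticKernel (f - g) :=
  ⟨hf.integrable.sub hg.integrable, fun ω hω ↦ by
    rw [angularFourier_sub hf.integrable hg.integrable, hf.antianalytic ω hω,
      hg.antianalytic ω hω, sub_zero]⟩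

lemma smul (c : ℂ) (hf : IsAntianalyticKernel f) : IsAntianalyticKernel (c • f) :=
  ⟨hf.integrable.smul c, fun ω hω ↦ by
    rw [angularFourier_smul, hf.antianalytic ω hω, mul_zero]⟩

lemma sum {ι : Type*} (s : Finset ι) {f : ι → ℝ → ℂ} (hf : ∀ k ∈ s, IsAntianalyticKernel (f k)) :
    IsAntianalyticKernel (∑ k ∈ s, f k) :=
  Finset.sum_induction f IsAntianalyticKernel (fun _ _ ↦ add) zero hf

lemma integral_eq_zero (hf : IsAntianalyticKernel f) : ∫ τ, f τ = 0 := by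
  rw [← angularFourier_zero_right]
  exact hf.antianalytic 0 le_rfl

end IsAntianalyticKernel

/-- The kernel against which the wavelet transform at time `t` and scale `s` integrates. -/
noncomputable def waveletKernel (ψ : ℝ → ℂ) (t s τ : ℝ) : ℂ :=
  ((1 / s : ℝ) : ℂ) * conj (ψ ((τ - t) / s))

lemma integrable_waveletKernel {ψ : ℝ → ℂ} (hψ : Integrable ψ) (t : ℝ) {s : ℝ} (hs : 0 < s) :
    Integrable (waveletKernel ψ t s) := by
  have h1 : Integrable fun τ ↦ ψ ((τ - t) / s) := (hψ.comp_div hs.ne').comp_sub_right t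
  exact ((LinearIsometryEquiv.integrable_comp_iff Complex.conjLIE).2 h1).const_mul _

lemma angularFourier_waveletKernel (ψ : ℝ → ℂ) (t : ℝ) {s : ℝ} (hs : 0 < s) (ω : ℝ) :
    angularFourier (waveletKernel ψ t s) ω =
      Complex.exp (-(Complex.I * t * ω)) * conj (angularFourier ψ (-(s * ω))) := by
  have hsc : (s : ℂ) ≠ 0 := by exact_mod_cast hs.ne'
  set G : ℝ → ℂ := fun u ↦ Complex.exp (-(Complex.I * u * (s * ω : ℝ))) * conj (ψ u) with hG
  have h1 : ∀ τ : ℝ, Complex.exp (-(Complex.I * τ * ω)) * waveletKernel ψ t s τ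
      = (Complex.exp (-(Complex.I * t * ω)) * ((1 / s : ℝ) : ℂ)) * G ((τ - t) / s) := by
    intro τ
    have : Complex.exp (-(Complex.I * τ * ω)) = Complex.exp (-(Complex.I * t * ω)) *
        Complex.exp (-(Complex.I * ((τ - t) / s : ℝ) * (s * ω : ℝ))) := by
      rw [← Complex.exp_add]
      congr 1
      push_cast
      field_simp
      ring
    rw [this, hG, waveletKernel]
    ring
  have h2 : ∫ τ, G ((τ - t) / s) = s * ∫ u, G u := by
    rw [integral_sub_right_eq_self (fun τ ↦ G (τ / s)) t, Measure.integral_comp_div,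
      abs_of_pos hs, Complex.real_smul]
  have h3 : ∫ u, G u = conj (angularFourier ψ (-(s * ω))) := angularFourier_conj ψ (s * ω)
  rw [angularFourier]
  simp only [h1]
  rw [integral_const_mul, h2, h3]
  push_cast
  field_simp

lemma IsAnalyticWavelet.isAntianalyticKernel {ψ : ℝ → ℂ} (hψ : IsAnalyticWavelet ψ) (t : ℝ)
    {s : ℝ} (hs : 0 < s) : IsAntianalyticKernel (waveletKernel ψ t s) := by
  refine ⟨integrable_waveletKernel hψ.integrable t hs, fun ω hω ↦ ?_⟩
  rw [angularFourier_waveletKernel ψ t hs, hψ.analytic _ (by nlinarith), map_zero, mul_zero]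

/-- A wavelet whose Fourier transform is invariant under a nontrivial dilation vanishes. -/
lemma IsAnalyticWavelet.ae_eq_zero_of_dilation {ψ : ℝ → ℂ} (hψ : IsAnalyticWavelet ψ) {r : ℝ}
    (hr0 : 0 ≤ r) (hr1 : r < 1) (h : ∀ ω, angularFourier ψ (r * ω) = angularFourier ψ ω) :
    ψ =ᵐ[volume] 0 := by
  refine ae_eq_zero_of_angularFourier_eq_zero hψ.integrable fun ω ↦ ?_
  have h1 : ∀ n : ℕ, angularFourier ψ (r ^ n * ω) = angularFourier ψ ω := by
    intro n
    induction n with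
    | zero => simp
    | succ n ih => rw [pow_succ', mul_assoc, h, ih]
  -- The dilates `rⁿ ω` tend to `0`, where `ψ̂` is continuous and zero.
  have h2 : Tendsto (fun n : ℕ ↦ angularFourier ψ (r ^ n * ω)) atTop (𝓝 (angularFourier ψ 0)) := by
    refine ((continuous_angularFourier hψ.integrable).tendsto 0).comp ?_
    simpa using (tendsto_pow_atTop_nhds_zero_of_lt_one hr0 hr1).mul_const ω
  simp only [h1] at h2
  rw [tendsto_nhds_unique tendsto_const_nhds h2, hψ.analytic 0 le_rfl]

end AntianalyticKernel

/-- With `c k = L(e_k) - i L(i e_k)`, every real functional of a vector of kernel integrals becomes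
the real part of a single one, with kernel `∑ c k • h k`. -/
lemma exists_forall_eq_re_sum {ι : Type*} [Fintype ι] (L : (ι → ℂ) →L[ℝ] ℝ) :
    ∃ c : ι → ℂ, ∀ z, L z = (∑ k, c k * z k).re := by
  classical
  refine ⟨fun k ↦ (L (Pi.single k 1) : ℂ) - L (Pi.single k Complex.I) * Complex.I, fun z ↦ ?_⟩
  have h1 : z = ∑ k, ((z k).re • (Pi.single k 1 : ι → ℂ) + (z k).im • (Pi.single k Complex.I : ι → ℂ)) := by
    conv_lhs => rw [← Finset.univ_sum_single z]
    refine Finset.sum_congr rfl fun k _ ↦ ?_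
    rw [← Pi.single_smul', ← Pi.single_smul', ← Pi.single_add]
    congr 1
    simp
  conv_lhs => rw [h1]
  rw [map_sum, Complex.re_sum]
  refine Finset.sum_congr rfl fun k _ ↦ ?_
  simp
  ring

/-! ### Circularity, exponential law and scalogram covariance. -/

section Noise

variable {Ω : Type*} [MeasurableSpace Ω] {P : Measure Ω} [IsProbabilityMeasure P]
  {Φ : ℝ → Ω → ℝ} {p : ℝ → ℝ}

namespace IsStationaryGaussianNoise

lemma integral_kernelIntegral_eq_zero (hΦ : IsStationaryGaussianNoise Φ P p) {h : ℝ → ℂ}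
    (hh : IsAntianalyticKernel h) : ∫ ω, kernelIntegral Φ h ω ∂P = 0 := by
  rw [hΦ.integral_kernelIntegral hh.integrable, hh.integral_eq_zero, mul_zero]

/-- The crux: `ĝ(ξ)` vanishes for `ξ ≥ 0` and `f̂(-ξ)` for `ξ ≤ 0`, so the spectral integrand is
identically zero. -/
lemma integral_kernelIntegral_mul_eq_zero (hΦ : IsStationaryGaussianNoise Φ P p) {f g : ℝ → ℂ}
    (hf : IsAntianalyticKernel f) (hg : IsAntianalyticKernel g) :
    ∫ ω, kernelIntegral Φ f ω * kernelIntegral Φ g ω ∂P = 0 := by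
  rw [hΦ.integral_kernelIntegral_mul hf.integrable hg.integrable hf.integral_eq_zero]
  refine integral_eq_zero_of_ae (ae_of_all _ fun ξ ↦ ?_)
  rcases le_total 0 ξ with h | h
  · simp [hg.antianalytic ξ h]
  · simp [hf.antianalytic (-ξ) (by linarith)]

/-- The spectral formula is applied to `h` and its conjugate. The latter need not be antianalytic,
since only the first kernel must have zero mean. -/
lemma integral_sq_norm_kernelIntegral (hΦ : IsStationaryGaussianNoise Φ P p) {h : ℝ → ℂ}
    (hh : IsAntianalyticKernel h) :
    ∫ ω, ‖kernelIntegral Φ h ω‖ ^ 2 ∂P = ∫ ξ, p ξ * ‖angularFourier h (-ξ)‖ ^ 2 := by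
  have hc : Integrable fun τ ↦ conj (h τ) :=
    (LinearIsometryEquiv.integrable_comp_iff Complex.conjLIE).2 hh.integrable
  have h1 := hΦ.integral_kernelIntegral_mul hh.integrable hc hh.integral_eq_zero
  simp only [angularFourier_conj, ← conj_kernelIntegral, Complex.mul_conj, Complex.normSq_eq_norm_sq,
    ← Complex.ofReal_mul, integral_complex_ofReal] at h1
  exact_mod_cast h1

lemma integral_re_kernelIntegral_eq_zero (hΦ : IsStationaryGaussianNoise Φ P p) {h : ℝ → ℂ}
    (hh : IsAntianalyticKernel h) : ∫ ω, (kernelIntegral Φ h ω).re ∂P = 0 := by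
  have h1 := integral_re (hΦ.integrable_kernelIntegral hh.integrable)
  simp only [RCLike.re_to_complex] at h1
  rw [h1, hΦ.integral_kernelIntegral_eq_zero hh, Complex.zero_re]

lemma variance_re_kernelIntegral (hΦ : IsStationaryGaussianNoise Φ P p) {h : ℝ → ℂ}
    (hh : IsAntianalyticKernel h) :
    Var[fun ω ↦ (kernelIntegral Φ h ω).re; P] = (∫ ω, ‖kernelIntegral Φ h ω‖ ^ 2 ∂P) / 2 := by
  rw [variance_of_integral_eq_zero
    (hΦ.hasGaussianLaw_re_kernelIntegral hh.integrable).aemeasurable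
    (hΦ.integral_re_kernelIntegral_eq_zero hh)]
  exact (integral_re_sq_of_integral_sq_eq_zero (hΦ.memLp_kernelIntegral hh.integrable)
    (hΦ.integral_kernelIntegral_mul_eq_zero hh hh)).1

lemma hasGaussianLaw_kernelIntegral (hΦ : IsStationaryGaussianNoise Φ P p) {ι : Type*} [Fintype ι]
    {h : ι → ℝ → ℂ} (hh : ∀ k, Integrable (h k)) :
    HasGaussianLaw (fun ω k ↦ kernelIntegral Φ (h k) ω) P := by
  have hm : AEMeasurable (fun ω k ↦ kernelIntegral Φ (h k) ω) P :=
    aemeasurable_pi_lambda _ fun k ↦ (hΦ.integrable_kernelIntegral (hh k)).aemeasurable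
  refine ⟨isGaussian_of_isGaussian_map fun L ↦ ?_⟩
  obtain ⟨c, hc⟩ := exists_forall_eq_re_sum L
  rw [AEMeasurable.map_map_of_aemeasurable (by fun_prop) hm]
  have hs : Integrable (∑ k, c k • h k) := integrable_finsetSum' _ fun k _ ↦ (hh k).smul (c k)
  refine ((hΦ.hasGaussianLaw_re_kernelIntegral hs).congr ?_).isGaussian_map
  filter_upwards [hΦ.kernelIntegral_sum_ae c hh] with ω hω
  rw [hω, Function.comp_apply, hc]

lemma isCircularlySymmetric_kernelIntegral (hΦ : IsStationaryGaussianNoise Φ P p) {d : ℕ}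
    {h : Fin d → ℝ → ℂ} (hh : ∀ k, IsAntianalyticKernel (h k)) :
    IsCircularlySymmetric (fun ω k ↦ kernelIntegral Φ (h k) ω) P := by
  intro θ
  set W : Ω → Fin d → ℂ := fun ω k ↦ kernelIntegral Φ (h k) ω
  set e : ℂ := Complex.exp (Complex.I * θ) with he
  have hen : ‖e‖ = 1 := by
    rw [he, mul_comm]
    exact Complex.norm_exp_ofReal_mul_I θ
  have gW : HasGaussianLaw W P := hΦ.hasGaussianLaw_kernelIntegral fun k ↦ (hh k).integrable
  have geW : HasGaussianLaw (fun ω ↦ e • W ω) P :=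
    gW.map_fun (e • ContinuousLinearMap.id ℝ (Fin d → ℂ))
  refine ⟨geW.aemeasurable, gW.aemeasurable, ?_⟩
  have := geW.isGaussian_map
  have := gW.isGaussian_map
  refine Measure.ext_of_charFunDual (funext fun L ↦ ?_)
  obtain ⟨c, hc⟩ := exists_forall_eq_re_sum L
  -- `L(W)` and `L(e • W)` are the real parts of the integrals against `k` and `e • k`. Both are
  -- Gaussian, so comparing mean and variance suffices.
  set k : ℝ → ℂ := ∑ j, c j • h j
  have hk : IsAntianalyticKernel k := .sum _ fun j _ ↦ (hh j).smul (c j)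
  have hsum := hΦ.kernelIntegral_sum_ae c fun j ↦ (hh j).integrable
  have e1 : (fun ω ↦ L (W ω)) =ᵐ[P] fun ω ↦ (kernelIntegral Φ k ω).re := by
    filter_upwards [hsum] with ω hω
    rw [hc, hω]
  have e2 : (fun ω ↦ L (e • W ω)) =ᵐ[P] fun ω ↦ (kernelIntegral Φ (e • k) ω).re := by
    filter_upwards [hsum] with ω hω
    rw [hc, kernelIntegral_smul, hω, Finset.mul_sum]
    simp only [Pi.smul_apply, smul_eq_mul, mul_left_comm, W]
  rw [gW.charFunDual_map_eq_fun, geW.charFunDual_map_eq_fun, variance_congr e1, variance_congr e2,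
    integral_congr_ae e1, integral_congr_ae e2, hΦ.variance_re_kernelIntegral hk,
    hΦ.variance_re_kernelIntegral (hk.smul e), hΦ.integral_re_kernelIntegral_eq_zero hk,
    hΦ.integral_re_kernelIntegral_eq_zero (hk.smul e)]
  simp only [kernelIntegral_smul, norm_mul, hen, one_mul]

lemma hasGaussianLaw_kernelIntegral_prodMk (hΦ : IsStationaryGaussianNoise Φ P p) {f g : ℝ → ℂ}
    (hf : Integrable f) (hg : Integrable g) :
    HasGaussianLaw (fun ω ↦ (kernelIntegral Φ f ω, kernelIntegral Φ g ω)) P := by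
  have h1 := (hΦ.hasGaussianLaw_kernelIntegral (h := ![f, g])
    (by simpa [Fin.forall_fin_two] using ⟨hf, hg⟩))
  exact h1.map_fun ((ContinuousLinearMap.proj 0).prod (ContinuousLinearMap.proj 1))

lemma hasLaw_sq_norm_kernelIntegral_div (hΦ : IsStationaryGaussianNoise Φ P p) {h : ℝ → ℂ}
    (hh : IsAntianalyticKernel h) {D : ℝ} (hD : 0 < D)
    (hhD : ∫ ω, ‖kernelIntegral Φ h ω‖ ^ 2 ∂P = D) :
    HasLaw (fun ω ↦ ‖kernelIntegral Φ h ω‖ ^ 2 / D) (expMeasure 1) P :=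
  HasGaussianLaw.hasLaw_sq_norm_div
    (hΦ.hasGaussianLaw_kernelIntegral_prodMk hh.integrable hh.integrable).fst
    (hΦ.integral_kernelIntegral_eq_zero hh) (hΦ.integral_kernelIntegral_mul_eq_zero hh hh) hD hhD

variable {ψ : ℝ → ℂ}

lemma integral_sq_norm_noiseAWT_sub (hΦ : IsStationaryGaussianNoise Φ P p)
    (hψ : IsAnalyticWavelet ψ) (t : ℝ) {s₁ s₂ : ℝ} (h₁ : 0 < s₁) (h₂ : 0 < s₂) :
    ∫ ω, ‖noiseAWT ψ Φ t s₁ ω - noiseAWT ψ Φ t s₂ ω‖ ^ 2 ∂P =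
      ∫ ξ, p ξ * ‖angularFourier ψ (s₁ * ξ) - angularFourier ψ (s₂ * ξ)‖ ^ 2 := by
  have k₁ := hψ.isAntianalyticKernel t h₁
  have k₂ := hψ.isAntianalyticKernel t h₂
  calc _ = ∫ ω, ‖kernelIntegral Φ (waveletKernel ψ t s₁ - waveletKernel ψ t s₂) ω‖ ^ 2 ∂P := by
        refine integral_congr_ae ?_
        filter_upwards [hΦ.kernelIntegral_sub_ae k₁.integrable k₂.integrable] with ω hω
        rw [hω]
        -- `noiseAWT ψ Φ t s` unfolds to `kernelIntegral Φ (waveletKernel ψ t s)`.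
        rfl
    _ = _ := by
        rw [hΦ.integral_sq_norm_kernelIntegral (k₁.sub k₂)]
        congr 1 with ξ
        rw [angularFourier_sub k₁.integrable k₂.integrable, angularFourier_waveletKernel ψ t h₁,
          angularFourier_waveletKernel ψ t h₂, ← mul_sub, norm_mul, norm_exp_neg_I_mul, one_mul,
          ← map_sub, RCLike.norm_conj]
        simp

/-- Time `t` contributes only a unimodular factor to the kernel's transform, so the distance defined
at time `0` serves every `t`. -/
lemma integral_sq_norm_noiseAWT_sub_eq (hΦ : IsStationaryGaussianNoise Φ P p)
    (hψ : IsAnalyticWavelet ψ) (t : ℝ) {s₁ s₂ : ℝ} (h₁ : 0 < s₁) (h₂ : 0 < s₂) :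
    ∫ ω, ‖noiseAWT ψ Φ t s₁ ω - noiseAWT ψ Φ t s₂ ω‖ ^ 2 ∂P = canonicalDist ψ Φ P s₁ s₂ ^ 2 := by
  rw [canonicalDist, Real.sq_sqrt (integral_nonneg fun _ ↦ by positivity),
    hΦ.integral_sq_norm_noiseAWT_sub hψ t h₁ h₂, hΦ.integral_sq_norm_noiseAWT_sub hψ 0 h₁ h₂]

lemma integral_mul_sq_norm_angularFourier_sub_pos (hp : ∀ ξ, 0 < p ξ) (hpi : Integrable p)
    (hψ : IsAnalyticWavelet ψ) (hψ0 : ¬ ψ =ᵐ[volume] 0) {s₁ s₂ : ℝ} (h₁ : 0 < s₁) (h₂ : 0 < s₂)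
    (hne : s₁ ≠ s₂) :
    0 < ∫ ξ, p ξ * ‖angularFourier ψ (s₁ * ξ) - angularFourier ψ (s₂ * ξ)‖ ^ 2 := by
  -- Ordering the scales makes the dilation ratio `s₁ / s₂` a contraction.
  wlog hlt : s₁ < s₂ generalizing s₁ s₂
  · simpa only [norm_sub_rev] using this h₂ h₁ hne.symm (lt_of_le_of_ne (not_lt.1 hlt) hne.symm)
  have hcont := continuous_angularFourier hψ.integrable
  set D : ℝ → ℝ := fun ξ ↦ ‖angularFourier ψ (s₁ * ξ) - angularFourier ψ (s₂ * ξ)‖ ^ 2 with hD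
  have hDc : Continuous D := by fun_prop
  have hbd : ∀ ω, ‖angularFourier ψ ω‖ ≤ ∫ t, ‖ψ t‖ := fun ω ↦
    (norm_integral_le_integral_norm _).trans_eq (by simp only [norm_mul, norm_exp_neg_I_mul, one_mul])
  have hDb : ∀ ξ, D ξ ≤ ((∫ t, ‖ψ t‖) + ∫ t, ‖ψ t‖) ^ 2 := fun ξ ↦ by
    refine pow_le_pow_left₀ (norm_nonneg _) ((norm_sub_le _ _).trans ?_) 2
    exact add_le_add (hbd _) (hbd _)
  have hint : Integrable fun ξ ↦ p ξ * D ξ := by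
    refine hpi.mul_bdd (c := ((∫ t, ‖ψ t‖) + ∫ t, ‖ψ t‖) ^ 2) hDc.aestronglyMeasurable
      (ae_of_all _ fun ξ ↦ ?_)
    rw [Real.norm_of_nonneg (by positivity)]
    exact hDb ξ
  have hnn : 0 ≤ fun ξ ↦ p ξ * D ξ := fun ξ ↦ mul_nonneg (hp ξ).le (by positivity)
  refine lt_of_le_of_ne (integral_nonneg hnn) fun h0 ↦ hψ0 ?_
  have hae := (integral_eq_zero_iff_of_nonneg hnn hint).1 h0.symm
  have hDae : D =ᵐ[volume] 0 := by
    filter_upwards [hae] with ξ hξ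
    exact (mul_eq_zero.1 hξ).resolve_left (hp ξ).ne'
  -- Continuity upgrades almost-everywhere vanishing to every frequency, as iterating the dilation
  -- requires.
  have hD0 : D = 0 := (hDc.ae_eq_iff_eq volume continuous_zero).1 hDae
  refine hψ.ae_eq_zero_of_dilation (r := s₁ / s₂) (by positivity) ((div_lt_one h₂).2 hlt) fun ω ↦ ?_
  have h3 := congrFun hD0 (ω / s₂)
  simp only [hD, Pi.zero_apply, ne_eq, OfNat.ofNat_ne_zero, not_false_eq_true, pow_eq_zero_iff,
    norm_eq_zero, sub_eq_zero] at h3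
  rw [show s₁ / s₂ * ω = s₁ * (ω / s₂) by ring, h3]
  congr 1
  field_simp

lemma canonicalDist_pos (hΦ : IsStationaryGaussianNoise Φ P p) (hψ : IsAnalyticWavelet ψ)
    (hψ0 : ¬ ψ =ᵐ[volume] 0) {s₁ s₂ : ℝ} (h₁ : 0 < s₁) (h₂ : 0 < s₂) (hne : s₁ ≠ s₂) :
    0 < canonicalDist ψ Φ P s₁ s₂ := by
  rw [canonicalDist, Real.sqrt_pos, hΦ.integral_sq_norm_noiseAWT_sub hψ 0 h₁ h₂]
  exact integral_mul_sq_norm_angularFourier_sub_pos hΦ.density_pos hΦ.density_integrable hψ hψ0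
    h₁ h₂ hne

lemma hasLaw_sq_norm_noiseAWT_sub (hΦ : IsStationaryGaussianNoise Φ P p) (hψ : IsAnalyticWavelet ψ)
    (hψ0 : ¬ ψ =ᵐ[volume] 0) (t : ℝ) {s₁ s₂ : ℝ} (h₁ : 0 < s₁) (h₂ : 0 < s₂) (hne : s₁ ≠ s₂) :
    HasLaw (fun ω ↦ ‖noiseAWT ψ Φ t s₁ ω - noiseAWT ψ Φ t s₂ ω‖ ^ 2 /
      canonicalDist ψ Φ P s₁ s₂ ^ 2) (expMeasure 1) P := by
  have k₁ := hψ.isAntianalyticKernel t h₁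
  have k₂ := hψ.isAntianalyticKernel t h₂
  have hae : kernelIntegral Φ (waveletKernel ψ t s₁ - waveletKernel ψ t s₂) =ᵐ[P]
      fun ω ↦ noiseAWT ψ Φ t s₁ ω - noiseAWT ψ Φ t s₂ ω :=
    hΦ.kernelIntegral_sub_ae k₁.integrable k₂.integrable
  have hD := pow_pos (hΦ.canonicalDist_pos hψ hψ0 h₁ h₂ hne) 2
  refine (hΦ.hasLaw_sq_norm_kernelIntegral_div (k₁.sub k₂) hD ?_).congr ?_
  · rw [← hΦ.integral_sq_norm_noiseAWT_sub_eq hψ t h₁ h₂]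
    refine integral_congr_ae ?_
    filter_upwards [hae] with ω hω
    rw [hω]
  · filter_upwards [hae] with ω hω
    rw [hω]

lemma covariance_noiseScalogram (hΦ : IsStationaryGaussianNoise Φ P p) (hψ : IsAnalyticWavelet ψ)
    (t : ℝ) {s₁ s₂ : ℝ} (h₁ : 0 < s₁) (h₂ : 0 < s₂) :
    cov[noiseScalogram ψ Φ t s₁, noiseScalogram ψ Φ t s₂; P] =
      4 * (∫ ω, (noiseAWT ψ Φ t s₁ ω).re * (noiseAWT ψ Φ t s₂ ω).re ∂P) ^ 2 +
      4 * (∫ ω, (noiseAWT ψ Φ t s₁ ω).re * (noiseAWT ψ Φ t s₂ ω).im ∂P) ^ 2 := by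
  have k₁ := hψ.isAntianalyticKernel t h₁
  have k₂ := hψ.isAntianalyticKernel t h₂
  exact HasGaussianLaw.covariance_sq_norm
    (hΦ.hasGaussianLaw_kernelIntegral_prodMk k₁.integrable k₂.integrable)
    (hΦ.integral_kernelIntegral_eq_zero k₁) (hΦ.integral_kernelIntegral_eq_zero k₂)
    (hΦ.integral_kernelIntegral_mul_eq_zero k₁ k₂)

lemma variance_noiseScalogram (hΦ : IsStationaryGaussianNoise Φ P p) (hψ : IsAnalyticWavelet ψ)
    (t : ℝ) {s : ℝ} (hs : 0 < s) :
    Var[noiseScalogram ψ Φ t s; P] = 4 * (∫ ω, |(noiseAWT ψ Φ t s ω).re| ^ 2 ∂P) ^ 2 ∧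
    Var[noiseScalogram ψ Φ t s; P] = (∫ ω, noiseScalogram ψ Φ t s ω ∂P) ^ 2 := by
  have k := hψ.isAntianalyticKernel t hs
  have hL : MemLp (noiseAWT ψ Φ t s) 2 P := hΦ.memLp_kernelIntegral k.integrable
  obtain ⟨h1, -, h3⟩ := integral_re_sq_of_integral_sq_eq_zero hL
    (hΦ.integral_kernelIntegral_mul_eq_zero k k)
  have hm : AEMeasurable (noiseScalogram ψ Φ t s) P :=
    hL.aestronglyMeasurable.aemeasurable.norm.pow_const 2
  have hV : Var[noiseScalogram ψ Φ t s; P] = 4 * (∫ ω, (noiseAWT ψ Φ t s ω).re ^ 2 ∂P) ^ 2 := by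
    -- At equal scales the cross term `E[Re W · Im W]` vanishes by `h3`.
    rw [← covariance_self hm, hΦ.covariance_noiseScalogram hψ t hs hs, h3]
    simp only [← sq]
    ring
  refine ⟨by simpa only [sq_abs] using hV, ?_⟩
  rw [hV, h1]
  simp only [noiseScalogram]
  ring

end IsStationaryGaussianNoise

end Noise

theorem mainTheorem7 {Ω : Type*} [MeasurableSpace Ω] (P : Measure Ω) [IsProbabilityMeasure P]
    (Φ : ℝ → Ω → ℝ) (p : ℝ → ℝ) (hΦ : IsStationaryGaussianNoise Φ P p)
    (ψ : ℝ → ℂ) (hψ : IsAnalyticWavelet ψ) :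
    -- the defining integral of `W_Φ(t, s)` converges absolutely almost surely
    (∀ t s : ℝ, 0 < s →
      ∀ᵐ ω ∂P, Integrable (fun τ ↦ waveletIntegrand ψ (fun u ↦ Φ u ω) t s τ)) ∧
    -- (a)
    (∀ (t : ℝ) (d : ℕ) (s : Fin d → ℝ), (∀ k, 0 < s k) →
      HasGaussianLaw (fun ω k ↦ noiseAWT ψ Φ t (s k) ω) P ∧
      IsCircularlySymmetric (fun ω k ↦ noiseAWT ψ Φ t (s k) ω) P) ∧
    -- (b)
    (¬ ψ =ᵐ[volume] 0 → ∀ t s₁ s₂ : ℝ, 0 < s₁ → 0 < s₂ → s₁ ≠ s₂ →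
      0 < canonicalDist ψ Φ P s₁ s₂ ∧
      HasLaw (fun ω ↦ ‖noiseAWT ψ Φ t s₁ ω - noiseAWT ψ Φ t s₂ ω‖ ^ 2 /
        canonicalDist ψ Φ P s₁ s₂ ^ 2) (expMeasure 1) P) ∧
    -- (c)
    (∀ t s₁ s₂ : ℝ, 0 < s₁ → 0 < s₂ →
      cov[noiseScalogram ψ Φ t s₁, noiseScalogram ψ Φ t s₂; P] =
          4 * (∫ ω, (noiseAWT ψ Φ t s₁ ω).re * (noiseAWT ψ Φ t s₂ ω).re ∂P) ^ 2 +
          4 * (∫ ω, (noiseAWT ψ Φ t s₁ ω).re * (noiseAWT ψ Φ t s₂ ω).im ∂P) ^ 2 ∧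
      0 ≤ cov[noiseScalogram ψ Φ t s₁, noiseScalogram ψ Φ t s₂; P]) ∧
    (∀ t s : ℝ, 0 < s →
      Var[noiseScalogram ψ Φ t s; P] =
          4 * (∫ ω, |(noiseAWT ψ Φ t s ω).re| ^ 2 ∂P) ^ 2 ∧
      Var[noiseScalogram ψ Φ t s; P] = (∫ ω, noiseScalogram ψ Φ t s ω ∂P) ^ 2) := by
  have hk (t : ℝ) {s : ℝ} (hs : 0 < s) := hψ.isAntianalyticKernel t hs
  refine ⟨fun t s hs ↦ hΦ.ae_integrable_mul (hk t hs).integrable, fun t d s hs ↦ ⟨?_, ?_⟩,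
    fun hψ0 t s₁ s₂ h₁ h₂ hne ↦ ⟨hΦ.canonicalDist_pos hψ hψ0 h₁ h₂ hne,
      hΦ.hasLaw_sq_norm_noiseAWT_sub hψ hψ0 t h₁ h₂ hne⟩,
    fun t s₁ s₂ h₁ h₂ ↦ ⟨hΦ.covariance_noiseScalogram hψ t h₁ h₂, ?_⟩,
    fun t s hs ↦ hΦ.variance_noiseScalogram hψ t hs⟩
  · exact hΦ.hasGaussianLaw_kernelIntegral fun k ↦ (hk t (hs k)).integrable
  · exact hΦ.isCircularlySymmetric_kernelIntegral fun k ↦ hk t (hs k)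
  · rw [hΦ.covariance_noiseScalogram hψ t h₁ h₂]
    positivity
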